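/- Let $\Bbbk$ be a field with $\operatorname{char}\Bbbk\neq 2$. **Operads.** An operad is a symmetric operad $\mathcal P=(\mathcal P(n))_{n\ge 0}$ of $\Bbbk$-vector spaces, given by right actions $*$ of $\mathbb S_n$ on $\mathcal P(n)$, an identity $1_{\mathcal P}\in\mathcal P(1)$ and partial compositions $\circ_i:\mathcal P(m)\otimes\mathcal P(n)\to\mathcal P(m+n-1)$ $(1\le i\le m)$ satisfying the usual unit, associativity and equivariance axioms, with $\mathcal P(0)=0$ and $\dim\mathcal P(n)<\infty$ for all $n$. It is $\mathbb A$-trivial if every alternating group $\mathbb A_n$ acts trivially on $\mathcal P(n)$. It is left torsionfree if $x=0$ is the only element for which $y\circ_i x=0$ for all $y\in\mathcal P(m)$, all $1\le i\le m$ and all $m\gg 0$. An ideal is an $\mathbb S$-stable graded subspace that is closed under partial composition with arbitrary elements on either side; $I\circ J$ denotes the $\mathbb S$-stable subspace generated by all $x\circ_i y$ with $x\in I$, $y\in J$; $\mathcal P$ is prime if $I\circ J\ne0$ for all nonzero ideals $I,J$. **Algebras.** Graded algebras $A=\bigoplus_{i\ge0}A_i$ are $\mathbb N$-graded, associative, unital,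 with $\dim A_i<\infty$ for all $i$, and here carry decompositions $A_i=A_{i,e}\oplus A_{i,o}$ for $i\ge1$; elements of $A_0$ and $A_{i,e}$ have type $t=0$, those of $A_{i,o}$ have type $t=1$, and homogeneous elements are those lying in one of $A_0$, $A_{i,e}$, $A_{i,o}$. Morphisms are homomorphisms of graded unital algebras that preserve the parts $A_{i,e}$, $A_{i,o}$. Let $x\mapsto x*\Xi$ be the map $\mathrm{id}_{A_{1,e}}-\mathrm{id}_{A_{1,o}}$ of $A_1$. $A$ is a PGPerm (pseudo-graded-Perm) algebra if * $\bigoplus_{i\ge1}A_{i,e}$ and $\bigoplus_{i\ge1}A_{i,o}$ are left ideals, and $\bigoplus_{i\ge2}A_{i,e}$ and $\bigoplus_{i\ge2}A_{i,o}$ are two-sided ideals; * $x(yz)=(-1)^{\deg(y)\deg(z)t(y)t(z)}\,x(zy)$ for all homogeneous $x\in A_{\ge2}$ and $y,z\in A$; * for $x\in A_1$: $(((xy)*\Xi)z)*\Xi=(((x*\Xi)z)*\Xi)y$ if $y,z\in A_0$; $((xy)*\Xi)z=((x*\Xi)z)y$ if $y\in A_0$ and $z$ is homogeneous of positive degree;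 $(-1)^{\deg(z)(\deg(y)-1)t(y)}(xy)z=(-1)^{(\deg(z)-1)t(z)}((x*\Xi)z)y$ if $y,z$ are homogeneous of positive degree. $A$ is a PGC (pseudo-graded-commutative) algebra if $\bigoplus_{i\ge1}A_{i,e}$ and $\bigoplus_{i\ge1}A_{i,o}$ are two-sided ideals and $yz=(-1)^{\deg(y)\deg(z)t(y)t(z)}zy$ for all homogeneous $y,z$. Every PGC algebra is a PGPerm algebra. $A$ is torsionfree if $x=0$ is the only $x\in A$ with $xA_{\ge n}=0$ for $n\gg0$, and also the only one with $A_{\ge n}x=0$ for $n\gg0$; $A$ is prime if $IJ\neq0$ for all nonzero two-sided ideals $I,J$. **Functors.** For an $\mathbb A$-trivial operad $\mathcal P$ let $F(\mathcal P)$ be the graded algebra with $A_i=\mathcal P(i+1)$, product $x\cdot y=x\circ_1y$, and, for $i\ge 1$, $A_{i,e}$ (resp. $A_{i,o}$) the part of $\mathcal P(i+1)$ on which $\mathbb S_{i+1}$ acts trivially (resp. by the sign); it is a PGPerm algebra. For a PGPerm algebra $A$ let $G(A)$ be the $\mathbb A$-trivial operad with $G(A)(0)=0$, $G(A)(n)=A_{n-1}$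 for $n\ge1$, on which for $n\ge 2$ the group $\mathbb S_n$ acts trivially on $A_{n-1,e}$ and by the sign on $A_{n-1,o}$, with identity $1_A$ and partial compositions, for homogeneous $x,y$ of arities $m,n$: $x\circ_iy=(-1)^{(n-1)(i-1)t(x)}xy$ if $m\ne2$ or $i=1$; and, for $m=2$, $x\circ_2y=((x*\Xi)y)*\Xi$ if $n=1$, $x\circ_2y=(-1)^{n\,t(y)}(x*\Xi)y$ if $n\ge2$. Both constructions are functors, acting on morphisms in the evident way. **Statement.** The functors $G$ and $F$ restrict to 1. mutually quasi-inverse equivalences between the category of torsionfree PGC algebras and the category of left torsionfree $\mathbb A$-trivial operads; 2. mutually quasi-inverse equivalences between the category of prime PGC algebras and the category of those prime $\mathbb A$-trivial operads $\mathcal P$ that are infinite dimensional or for which the algebra $(\mathcal P(1),\circ_1)$ is commutative. In particular, infinite dimensional prime PGC algebras correspond to infinite dimensional prime $\mathbb A$-trivial operads. -/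

import Mathlib

open CategoryTheory DirectSum

universe u v

namespace ATrivial

/-- The inputs of a composite of an operation with `m` inputs (numbered from `0`) and an operation
with `n` inputs, the latter plugged into input `i` of the former. The composite has `p = m + n - 1`
inputs: those of the outer operation other than `i`, and those of the inner one. In the order of the
composite, the inputs of the inner operation occupy the block of places `i, ..., i + n - 1`. -/
def slotFun {m n p : ℕ} (h : m + n = p + 1) (i : Fin m) : {j : Fin m // j ≠ i} ⊕ Fin n → Fin p
  | .inl j => if hj : j.1 < i then ⟨j.1, by have := i.2; omega⟩ else
      ⟨j.1 + n - 1, by have := j.1.2; have := Fin.val_ne_iff.2 j.2; omega⟩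
  | .inr b => ⟨i + b, by have := i.2; have := b.2; omega⟩

theorem slotFun_bijective {m n p : ℕ} (h : m + n = p + 1) (i : Fin m) :
    Function.Bijective (slotFun h i) := by
  rw [Fintype.bijective_iff_injective_and_card]
  constructor
  · rintro (⟨a, ha⟩ | a) (⟨b, hb⟩ | b) hab <;>
      simp only [slotFun] at hab
    · have ha := Fin.val_ne_iff.2 ha
      have hb := Fin.val_ne_iff.2 hb
      have : a = b := by
        split_ifs at hab with h1 h2 h2 <;> simp only [Fin.mk.injEq] at hab <;>
        apply Fin.ext <;> have := i.2 <;> simp only [Fin.lt_def] at * <;> omega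
      subst this; rfl
    · have ha := Fin.val_ne_iff.2 ha
      exfalso
      split_ifs at hab with h1 <;> simp only [Fin.mk.injEq] at hab <;>
        have := b.2 <;> simp only [Fin.lt_def] at * <;> omega
    · have hb := Fin.val_ne_iff.2 hb
      exfalso
      split_ifs at hab with h1 <;> simp only [Fin.mk.injEq] at hab <;>
        have := a.2 <;> simp only [Fin.lt_def] at * <;> omega
    · simp only [Fin.mk.injEq] at hab
      congr 1
      apply Fin.ext; omega
  · have := i.2
    simp [Fintype.card_subtype_compl]
    omega

/-- `slotFun` as a bijection. -/
noncomputable def slot {m n p : ℕ} (h : m + n = p + 1) (i : Fin m) :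
    {j : Fin m // j ≠ i} ⊕ Fin n ≃ Fin p :=
  Equiv.ofBijective _ (slotFun_bijective h i)

theorem slot_inl_val {m n p : ℕ} (h : m + n = p + 1) (i : Fin m) (j) :
    (slot h i (.inl j)).1 = if j.1 < i then j.1.1 else j.1.1 + n - 1 := by
  simp only [slot, Equiv.ofBijective_apply, slotFun]
  split_ifs <;> simp_all
theorem slot_inr_val {m n p : ℕ} (h : m + n = p + 1) (i : Fin m) (b) :
    (slot h i (.inr b)).1 = i + b := by
  simp only [slot, Equiv.ofBijective_apply, slotFun]

/-- The bijection that `φ` induces from the inputs other than `i` to those other than `φ i`. -/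
def offEquiv {m : ℕ} (φ : Equiv.Perm (Fin m)) (i : Fin m) :
    {j : Fin m // j ≠ i} ≃ {j : Fin m // j ≠ φ i} :=
  φ.subtypeEquiv fun j => (φ.injective.ne_iff (x := j) (y := i)).symm

/-- The block permutation `ϑ_{m;1,...,1,n,1,...,1}(φ; id,..., id, σ, id,..., id)` of the inputs of a
composite: it permutes the `m` blocks (of which the `i`-th has size `n` and the others size `1`) as
`φ` does, and the elements of the block of size `n` as `σ` does.
It is characterized by `blockPerm_inl_val` and `blockPerm_inr_val`.
For `φ = 1` it is the permutation `σ'` with `μ ∘_i (ν * σ) = (μ ∘_i ν) * σ'`, and for `σ = 1` the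
permutation `φ''` with `(μ * φ) ∘_i ν = (μ ∘_{φ(i)} ν) * φ''`. -/
noncomputable def blockPerm {m n p : ℕ} (h : m + n = p + 1) (i : Fin m)
    (φ : Equiv.Perm (Fin m)) (σ : Equiv.Perm (Fin n)) : Equiv.Perm (Fin p) :=
  (slot h i).symm.trans (((offEquiv φ i).sumCongr σ).trans (slot h (φ i)))

theorem blockPerm_slot {m n p : ℕ} (h : m + n = p + 1) (i : Fin m)
    (φ : Equiv.Perm (Fin m)) (σ : Equiv.Perm (Fin n)) (s) :
    blockPerm h i φ σ (slot h i s) = slot h (φ i) ((offEquiv φ i).sumCongr σ s) := by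
  simp [blockPerm]

theorem blockPerm_inl_val {m n p : ℕ} (h : m + n = p + 1) (i : Fin m)
    (φ : Equiv.Perm (Fin m)) (σ : Equiv.Perm (Fin n)) (j) :
    (blockPerm h i φ σ (slot h i (.inl j))).1 =
      if φ j.1 < φ i then (φ j.1).1 else (φ j.1).1 + n - 1 := by
  rw [blockPerm_slot]
  exact slot_inl_val h (φ i) (offEquiv φ i j)

theorem blockPerm_inr_val {m n p : ℕ} (h : m + n = p + 1) (i : Fin m)
    (φ : Equiv.Perm (Fin m)) (σ : Equiv.Perm (Fin n)) (b) :
    (blockPerm h i φ σ (slot h i (.inr b))).1 = φ i + σ b := by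
  rw [blockPerm_slot]
  simp only [slot, Equiv.ofBijective_apply, slotFun, Equiv.sumCongr_apply, Sum.map_inr]

theorem blockPerm_mul {m n p : ℕ} (h : m + n = p + 1) (i : Fin m)
    (φ ψ : Equiv.Perm (Fin m)) (σ τ : Equiv.Perm (Fin n)) :
    blockPerm h i (φ * ψ) (σ * τ) = blockPerm h (ψ i) φ σ * blockPerm h i ψ τ := by
  ext t
  obtain ⟨s, rfl⟩ := (slot h i).surjective t
  rw [Equiv.Perm.mul_apply, blockPerm_slot, blockPerm_slot, blockPerm_slot]
  rcases s with s | s <;> rfl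

theorem sign_blockPerm_one_left {m n p : ℕ} (h : m + n = p + 1) (i : Fin m)
    (σ : Equiv.Perm (Fin n)) :
    Equiv.Perm.sign (blockPerm h i 1 σ) = Equiv.Perm.sign σ := by
  have : blockPerm h i 1 σ = (slot h i).symm.trans
    ((Equiv.Perm.sumCongr (1 : Equiv.Perm {j : Fin m // j ≠ i}) σ).trans (slot h i)) := by
    ext t
    obtain ⟨s, rfl⟩ := (slot h i).surjective t
    rw [blockPerm_slot]
    rcases s with s | s <;> simp <;> rfl
  rw [this]
  refine (Equiv.Perm.sign_symm_trans_trans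
    (Equiv.Perm.sumCongr (1 : Equiv.Perm {j : Fin m // j ≠ i}) σ) (slot h i)).trans ?_
  rw [Equiv.Perm.sign_sumCongr]; simp


theorem sign_blockPerm_swap {m n p : ℕ} (h : m + n = p + 1) (i a b : Fin m) (hab : a.1 + 1 = b.1) :
    Equiv.Perm.sign (blockPerm h i (Equiv.swap a b) (1 : Equiv.Perm (Fin n))) =
     if i = a ∨ i = b then (-1) ^ n else -1 := by
  have hne : a ≠ b := by rintro rfl; omega
  have key : ∀ (i b : Fin m) (hab : i.1 + 1 = b.1),
     Equiv.Perm.sign (blockPerm h i (Equiv.swap i b) (1 : Equiv.Perm (Fin n))) = (-1) ^ n := by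
    intro i b hab
    have hne : i ≠ b := by rintro rfl; omega
    have : NeZero p := ⟨by have := b.2; omega⟩
    have : (blockPerm h i (Equiv.swap i b) (1 : Equiv.Perm (Fin n))) =
        Fin.cycleIcc (⟨i, by have := b.2; omega⟩ : Fin p) ⟨i + n, by have := b.2; omega⟩ := by
      ext t
      obtain ⟨s, rfl⟩ := (slot h i).surjective t
      rcases s with ⟨j, hj⟩ | c
      · rw [blockPerm_inl_val, Equiv.swap_apply_left]
        have hv := slot_inl_val h i ⟨j, hj⟩
        have hj' := Fin.val_ne_iff.2 hj
        by_cases hjb : j = b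
        · subst hjb
          have hlt : ¬ j < i := by rw [Fin.lt_def]; omega
          simp only [hlt, if_false] at hv
          have : slot h i (Sum.inl ⟨j, hj⟩) = ⟨i + n, by have := j.2; omega⟩ := Fin.ext (by simp [hv]; omega)
          rw [this, Fin.cycleIcc_of_last (by simp [Fin.le_def])]
          simp [Fin.lt_def, ← hab]
        · have hjb' := Fin.val_ne_iff.2 hjb
          rw [Equiv.swap_apply_of_ne_of_ne hj hjb]
          by_cases hlt : j < i
          · simp only [hlt, if_true] at hv
            rw [Fin.cycleIcc_of_lt (by rw [Fin.lt_def, hv]; exact hlt), hv, if_pos]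
            rw [Fin.lt_def] at *; omega
          · simp only [hlt, if_false] at hv
            rw [Fin.lt_def] at hlt
            rw [Fin.cycleIcc_of_gt (by rw [Fin.lt_def, hv]; dsimp only; omega), hv, if_neg]
            rw [Fin.lt_def]; omega
      · rw [blockPerm_inr_val, Equiv.swap_apply_left]
        have hv := slot_inr_val h i c
        have hc := c.2
        rw [Fin.cycleIcc_of_ge_of_lt (by rw [Fin.le_def, hv]; simp)
          (by rw [Fin.lt_def, hv]; simp)]
        rw [Fin.val_add, hv, Fin.val_one', Nat.add_mod_mod, Nat.mod_eq_of_lt (by have := b.2; omega)]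
        simp; omega
    rw [this, Fin.sign_cycleIcc_of_le (by simp [Fin.le_def])]
    simp
  split_ifs with hi
  · rcases hi with rfl | rfl
    · exact key _ _ hab
    · have h1 := blockPerm_mul h i (Equiv.swap a i) (Equiv.swap a i) (1 : Equiv.Perm (Fin n)) 1
      have h2 := congrArg Equiv.Perm.sign h1
      rw [Equiv.swap_mul_self, mul_one, sign_blockPerm_one_left, Equiv.swap_apply_right,
        Equiv.Perm.sign_mul, key _ _ hab, Equiv.Perm.sign_one] at h2
      have h3 := congrArg (fun t => (-1 : ℤˣ) ^ n * t) h2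
      simp only [mul_one, ← mul_assoc, ← mul_pow] at h3
      simpa using h3.symm
  · push Not at hi
    have ha : (a : ℕ) ≠ i := Fin.val_ne_iff.2 hi.1.symm
    have hb : (b : ℕ) ≠ i := Fin.val_ne_iff.2 hi.2.symm
    have : blockPerm h i (Equiv.swap a b) (1 : Equiv.Perm (Fin n)) =
      Equiv.swap (slot h i (.inl ⟨a, hi.1.symm⟩)) (slot h i (.inl ⟨b, hi.2.symm⟩)) := by
      ext t
      obtain ⟨s, rfl⟩ := (slot h i).surjective t
      rw [← Function.Injective.map_swap (slot h i).injective]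
      rcases s with ⟨j, hj⟩ | c
      · rw [blockPerm_inl_val, Equiv.swap_apply_of_ne_of_ne hi.1 hi.2]
        by_cases hja : j = a
        · subst hja
          simp [slot_inl_val]
        · by_cases hjb : j = b
          · subst hjb
            simp [slot_inl_val]
          · rw [Equiv.swap_apply_of_ne_of_ne hja hjb,
              Equiv.swap_apply_of_ne_of_ne (by simpa using hja) (by simpa using hjb), slot_inl_val]
      · rw [blockPerm_inr_val, Equiv.swap_apply_of_ne_of_ne hi.1 hi.2,
          Equiv.swap_apply_of_ne_of_ne (by simp) (by simp), slot_inr_val]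
        simp
    rw [this, Equiv.Perm.sign_swap]
    simp [hne]

theorem sign_blockPerm {m n p : ℕ} (h : m + n = p + 1) (i : Fin m)
    (φ : Equiv.Perm (Fin m)) (σ : Equiv.Perm (Fin n)) :
    Equiv.Perm.sign (blockPerm h i φ σ) =
      (-1) ^ ((n + 1) * ((φ i : ℕ) + i)) * Equiv.Perm.sign φ * Equiv.Perm.sign σ := by
  have h1 : blockPerm h i φ σ = blockPerm h i φ 1 * blockPerm h i 1 σ := by
    simpa using blockPerm_mul h i φ 1 1 σ
  rw [h1, Equiv.Perm.sign_mul, sign_blockPerm_one_left]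
  congr 1
  clear h1
  obtain ⟨m, rfl⟩ : ∃ m', m = m' + 1 := ⟨m - 1, by have := i.2; omega⟩
  have hφ : φ ∈ Submonoid.closure
      (Set.range fun i : Fin m => Equiv.swap i.castSucc i.succ) := by
    rw [Equiv.Perm.mclosure_swap_castSucc_succ]; trivial
  induction hφ using Submonoid.closure_induction generalizing i with
  | one =>
    rw [sign_blockPerm_one_left, Equiv.Perm.one_apply, Even.neg_one_pow]
    · simp
    · exact Even.mul_left ⟨(i : ℕ), rfl⟩ _
  | mem x hx =>
    obtain ⟨a, rfl⟩ := hx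
    dsimp only
    rw [sign_blockPerm_swap h i _ _ (by simp), Equiv.Perm.sign_swap (by simp [Fin.ext_iff])]
    split_ifs with hi
    · rcases hi with rfl | rfl
      · rw [Equiv.swap_apply_left]
        have : (n + 1) * ((a.succ : ℕ) + (a.castSucc : ℕ)) = 2 * ((n + 1) * a) + n + 1 := by
          simp; ring
        rw [this, pow_succ, pow_add, pow_mul]; simp
      · rw [Equiv.swap_apply_right]
        have : (n + 1) * ((a.castSucc : ℕ) + (a.succ : ℕ)) = 2 * ((n + 1) * a) + n + 1 := by
          simp; ring
        rw [this, pow_succ, pow_add, pow_mul]; simp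
    · push Not at hi
      rw [Equiv.swap_apply_of_ne_of_ne hi.1 hi.2, Even.neg_one_pow (Even.mul_left ⟨(i : ℕ), rfl⟩ _), one_mul]
  | mul x y _ _ hx hy =>
    have : blockPerm h i (x * y) (1 : Equiv.Perm (Fin n)) =
      blockPerm h (y i) x 1 * blockPerm h i y 1 := by rw [← blockPerm_mul, mul_one]
    rw [this, Equiv.Perm.sign_mul, hx, hy, Equiv.Perm.sign_mul, Equiv.Perm.mul_apply]
    have e : (-1 : ℤˣ) ^ ((n + 1) * ((x (y i) : ℕ) + i)) =
      (-1) ^ ((n + 1) * ((x (y i) : ℕ) + y i)) * (-1) ^ ((n + 1) * ((y i : ℕ) + i)) := by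
      rw [← pow_add, show (n + 1) * ((x (y i) : ℕ) + y i) + (n + 1) * ((y i : ℕ) + i) =
        (n + 1) * ((x (y i) : ℕ) + i) + 2 * ((n + 1) * (y i : ℕ)) by ring, pow_add _ _ (2 * _), pow_mul _ 2]
      simp
    rw [e]
    simp only [mul_assoc, mul_left_comm, mul_comm]

/-- A reduced, locally finite, symmetric operad in vector spaces over `k`, by partial compositions.
`Op n` is the space of operations of arity `n`; `act σ x` is the right action `x * σ` of the symmetric
group; inputs are numbered from `0`, so `circ h i x y` is the partial composite usually written
`x ∘_{i+1} y`, for `x` of arity `m` and `y` of arity `n`, of arity `p = m + n - 1` (written as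
`h : m + n = p + 1`). The fields `circ_one`, `one_circ` are the unit laws, `circ_assoc` is
`(x ∘_i y) ∘_{i-1+j} z = x ∘_i (y ∘_j z)`, `circ_comm` is
`(x ∘_i y) ∘_{K-1+m} z = (x ∘_K z) ∘_i y` for `i < K` (both in 1-based numbering), and the last two
laws are the equivariance of the partial compositions. -/
structure Operad (k : Type u) [Field k] where
  Op : ℕ → Type v
  [acg : ∀ n, AddCommGroup (Op n)]
  [mod : ∀ n, Module k (Op n)]
  act : ∀ {n : ℕ}, Equiv.Perm (Fin n) → Op n →ₗ[k] Op n
  one : Op 1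
  circ : ∀ {m n p : ℕ}, m + n = p + 1 → Fin m → Op m →ₗ[k] Op n →ₗ[k] Op p
  act_one : ∀ {n : ℕ} (x : Op n), act 1 x = x
  act_mul : ∀ {n : ℕ} (σ τ : Equiv.Perm (Fin n)) (x : Op n), act (σ * τ) x = act τ (act σ x)
  circ_one : ∀ {n : ℕ} (i : Fin n) (θ : Op n), circ rfl i θ one = θ
  one_circ : ∀ {n : ℕ} (θ : Op n), circ (Nat.add_comm 1 n) 0 one θ = θ
  circ_assoc : ∀ {l m n q r s : ℕ} (hq : l + m = q + 1) (hs : q + n = s + 1)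
    (hr : m + n = r + 1) (hs' : l + r = s + 1) (i : Fin l) (j : Fin m)
    (x : Op l) (y : Op m) (z : Op n),
    circ hs ⟨i + j, by omega⟩ (circ hq i x y) z = circ hs' i x (circ hr j y z)
  circ_comm : ∀ {l m n q r s : ℕ} (hq : l + m = q + 1) (hs : q + n = s + 1)
    (hr : l + n = r + 1) (hs' : r + m = s + 1) (i K : Fin l) (hiK : i < K)
    (x : Op l) (y : Op m) (z : Op n),
    circ hs ⟨K + m - 1, by rw [Fin.lt_def] at hiK; omega⟩ (circ hq i x y) z =
      circ hs' ⟨i, by rw [Fin.lt_def] at hiK; omega⟩ (circ hr K x z) y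
  circ_act_right : ∀ {m n p : ℕ} (h : m + n = p + 1) (i : Fin m) (σ : Equiv.Perm (Fin n))
    (x : Op m) (y : Op n), circ h i x (act σ y) = act (blockPerm h i 1 σ) (circ h i x y)
  circ_act_left : ∀ {m n p : ℕ} (h : m + n = p + 1) (i : Fin m) (φ : Equiv.Perm (Fin m))
    (x : Op m) (y : Op n), circ h i (act φ x) y = act (blockPerm h i φ 1) (circ h (φ i) x y)
  reduced : Subsingleton (Op 0)
  [locallyFinite : ∀ n, FiniteDimensional k (Op n)]

attribute [instance] Operad.acg Operad.mod Operad.locallyFinite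

variable {k : Type u} [Field k]

/-- Morphisms of operads. -/
@[ext]
structure Operad.Hom (P Q : Operad.{u, v} k) where
  map : ∀ n : ℕ, P.Op n →ₗ[k] Q.Op n
  map_act : ∀ {n : ℕ} (σ : Equiv.Perm (Fin n)) (x : P.Op n), map n (P.act σ x) = Q.act σ (map n x)
  map_one : map 1 P.one = Q.one
  map_circ : ∀ {m n p : ℕ} (h : m + n = p + 1) (i : Fin m) (x : P.Op m) (y : P.Op n),
    map p (P.circ h i x y) = Q.circ h i (map m x) (map n y)

instance : Category (Operad.{u, v} k) where
  Hom P Q := Operad.Hom P Q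
  id P := ⟨fun _ => LinearMap.id, fun _ _ => rfl, rfl, fun _ _ _ _ => rfl⟩
  comp f g := ⟨fun n => g.map n ∘ₗ f.map n, fun σ x => by simp [f.map_act, g.map_act],
    by simp [f.map_one, g.map_one], fun h i x y => by simp [f.map_circ, g.map_circ]⟩

/-- `𝔸`-trivial operads: every alternating group acts trivially. -/
def aTrivial : ObjectProperty (Operad.{u, v} k) := fun P =>
  ∀ (n : ℕ) (σ : Equiv.Perm (Fin n)), σ ∈ alternatingGroup (Fin n) → ∀ x : P.Op n, P.act σ x = x

/-- Left torsionfree operads: `x = 0` whenever all composites `y ∘_i x` with `y` of large arity vanish. -/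
def leftTorsionfree : ObjectProperty (Operad.{u, v} k) := fun P =>
  ∀ (n : ℕ) (x : P.Op n),
    (∃ N : ℕ, ∀ m ≥ N, ∀ (p : ℕ) (h : m + n = p + 1) (i : Fin m) (y : P.Op m),
      P.circ h i y x = 0) → x = 0

/-- (Two-sided) ideals of an operad. -/
structure Operad.IsIdeal (P : Operad.{u, v} k) (I : ∀ n, Submodule k (P.Op n)) : Prop where
  act_mem : ∀ {n : ℕ} (σ : Equiv.Perm (Fin n)) {x : P.Op n}, x ∈ I n → P.act σ x ∈ I n
  circ_mem_left : ∀ {m n p : ℕ} (h : m + n = p + 1) (i : Fin m) {x : P.Op m} (y : P.Op n),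
    x ∈ I m → P.circ h i x y ∈ I p
  circ_mem_right : ∀ {m n p : ℕ} (h : m + n = p + 1) (i : Fin m) (x : P.Op m) {y : P.Op n},
    y ∈ I n → P.circ h i x y ∈ I p

/-- The subspace `I ∘ J = (∑_i I ∘_i J) * 𝕊`, arity by arity. -/
def Operad.subspaceCirc (P : Operad.{u, v} k) (I J : ∀ n, Submodule k (P.Op n)) (p : ℕ) :
    Submodule k (P.Op p) :=
  Submodule.span k {z | ∃ (m n : ℕ) (h : m + n = p + 1) (i : Fin m), ∃ x ∈ I m, ∃ y ∈ J n,
    ∃ σ : Equiv.Perm (Fin p), z = P.act σ (P.circ h i x y)}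

/-- Prime operads: `I ∘ J ≠ 0` for all nonzero ideals `I` and `J`. -/
def primeOperad : ObjectProperty (Operad.{u, v} k) := fun P =>
  ∀ I J : ∀ n, Submodule k (P.Op n), P.IsIdeal I → P.IsIdeal J → I ≠ ⊥ → J ≠ ⊥ →
    P.subspaceCirc I J ≠ ⊥

/-- A locally finite `ℕ`-graded unital associative `k`-algebra `A = ⨁ A_i` with a decomposition
`A_i = A_{i,e} ⊕ A_{i,o}` for `i ≥ 1`. In degree `0` there is no decomposition; as the elements of
`A_0` have type `t = 0`, this is encoded by `e 0 = A_0` and `o 0 = 0`. -/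
structure TypedGradedAlgebra (k : Type u) [Field k] where
  A : ℕ → Type v
  [acg : ∀ i, AddCommGroup (A i)]
  [mod : ∀ i, Module k (A i)]
  [ring : DirectSum.GRing A]
  [alg : DirectSum.GAlgebra k A]
  [locallyFinite : ∀ i, FiniteDimensional k (A i)]
  e : ∀ i, Submodule k (A i)
  o : ∀ i, Submodule k (A i)
  isCompl : ∀ i, IsCompl (e i) (o i)
  o_zero : o 0 = ⊥

attribute [instance] TypedGradedAlgebra.acg TypedGradedAlgebra.mod TypedGradedAlgebra.ring
  TypedGradedAlgebra.alg TypedGradedAlgebra.locallyFinite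

namespace TypedGradedAlgebra

/-- The algebra `⨁ A_i`. -/
abbrev Total (A : TypedGradedAlgebra.{u, v} k) : Type v := ⨁ i, A.A i

/-- The inclusion of `A_i` into the algebra. -/
abbrev of (A : TypedGradedAlgebra.{u, v} k) (i : ℕ) : A.A i →ₗ[k] A.Total :=
  DirectSum.lof k ℕ A.A i

/-- Homomorphisms of graded algebras preserving the parts of even and of odd type. -/
@[ext]
structure Hom (A B : TypedGradedAlgebra.{u, v} k) where
  map : ∀ i : ℕ, A.A i →ₗ[k] B.A i
  map_one : map 0 (GradedMonoid.GOne.one) = GradedMonoid.GOne.one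
  map_mul : ∀ {i j : ℕ} (x : A.A i) (y : A.A j),
    map (i + j) (GradedMonoid.GMul.mul x y) = GradedMonoid.GMul.mul (map i x) (map j y)
  map_e : ∀ {i : ℕ} {x : A.A i}, x ∈ A.e i → map i x ∈ B.e i
  map_o : ∀ {i : ℕ} {x : A.A i}, x ∈ A.o i → map i x ∈ B.o i

instance : Category (TypedGradedAlgebra.{u, v} k) where
  Hom A B := Hom A B
  id A := ⟨fun _ => LinearMap.id, rfl, fun _ _ => rfl, fun h => h, fun h => h⟩
  comp f g := ⟨fun i => g.map i ∘ₗ f.map i, by simp [f.map_one, g.map_one],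
    fun x y => by simp [f.map_mul, g.map_mul], fun h => g.map_e (f.map_e h),
    fun h => g.map_o (f.map_o h)⟩

/-- The elements of degree `i` and type `t`: `A_{i,e}` for `t = 0` and `A_{i,o}` for `t = 1`. -/
def part (A : TypedGradedAlgebra.{u, v} k) (t : Fin 2) (i : ℕ) : Submodule k (A.A i) :=
  if t = 0 then A.e i else A.o i

/-- The map that is the identity on `A_{i,e}` and multiplication by the sign `c` on `A_{i,o}`. -/
noncomputable def twist (A : TypedGradedAlgebra.{u, v} k) (c : ℤˣ) (i : ℕ) : A.A i →ₗ[k] A.A i :=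
  (A.e i).projection (A.o i) (A.isCompl i) +
    (c : ℤ) • (A.o i).projection (A.e i) (A.isCompl i).symm

/-- The map `(-) * Ξ = id_{A_{1,e}} - id_{A_{1,o}}` of `A_1`. -/
noncomputable def Xi (A : TypedGradedAlgebra.{u, v} k) : A.A 1 →ₗ[k] A.A 1 := A.twist (-1) 1

/-- The multiplication `A_i × A_j → A_p` where `p = i + j`. -/
noncomputable def mul (A : TypedGradedAlgebra.{u, v} k) {i j p : ℕ} (h : i + j = p) :
    A.A i →ₗ[k] A.A j →ₗ[k] A.A p :=
  h ▸ DirectSum.gMulLHom k A.A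

/-- Pseudo-graded-Perm (PGPerm) algebras.
The elements of type `t` and positive degree form a left ideal (`left_ideal`) and those of degree at
least `2` a two-sided ideal (`left_ideal`, `right_ideal`). -/
structure IsPGPerm (A : TypedGradedAlgebra.{u, v} k) : Prop where
  left_ideal : ∀ {i j p : ℕ} (t : Fin 2) (h : i + j = p) (a : A.A i) (x : A.A j), 1 ≤ j →
    x ∈ A.part t j → A.mul h a x ∈ A.part t p
  right_ideal : ∀ {i j p : ℕ} (t : Fin 2) (h : i + j = p) (x : A.A i) (a : A.A j), 2 ≤ i →
    x ∈ A.part t i → A.mul h x a ∈ A.part t p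
  perm : ∀ {i j l : ℕ} (s t : Fin 2) (x : A.A i) (y : A.A j) (z : A.A l), 2 ≤ i →
    y ∈ A.part s j → z ∈ A.part t l →
    A.of i x * (A.of j y * A.of l z) =
      (-1 : k) ^ (j * l * s * t) • (A.of i x * (A.of l z * A.of j y))
  va : ∀ (x : A.A 1) (y z : A.A 0),
    A.Xi (A.mul rfl (A.Xi (A.mul rfl x y)) z) = A.mul rfl (A.Xi (A.mul rfl (A.Xi x) z)) y
  vb : ∀ {j p : ℕ} (t : Fin 2) (h : 1 + j = p) (x : A.A 1) (y : A.A 0) (z : A.A j), 1 ≤ j →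
    z ∈ A.part t j →
    A.mul h (A.Xi (A.mul rfl x y)) z = A.mul rfl (A.mul h (A.Xi x) z) y
  vc : ∀ {j l : ℕ} (s t : Fin 2) (x : A.A 1) (y : A.A j) (z : A.A l), 1 ≤ j → 1 ≤ l →
    y ∈ A.part s j → z ∈ A.part t l →
    (-1 : k) ^ (l * (j - 1) * s) • ((A.of 1 x * A.of j y) * A.of l z) =
      (-1 : k) ^ ((l - 1) * t) • ((A.of 1 (A.Xi x) * A.of l z) * A.of j y)

/-- Pseudo-graded-commutative (PGC) algebras: the elements of type `t` and positive degree form a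
two-sided ideal, and `y z = (-1)^{deg y deg z t(y) t(z)} z y` for homogeneous `y` and `z`. -/
structure IsPGC (A : TypedGradedAlgebra.{u, v} k) : Prop where
  left_ideal : ∀ {i j p : ℕ} (t : Fin 2) (h : i + j = p) (a : A.A i) (x : A.A j), 1 ≤ j →
    x ∈ A.part t j → A.mul h a x ∈ A.part t p
  right_ideal : ∀ {i j p : ℕ} (t : Fin 2) (h : i + j = p) (x : A.A i) (a : A.A j), 1 ≤ i →
    x ∈ A.part t i → A.mul h x a ∈ A.part t p
  comm : ∀ {i j : ℕ} (s t : Fin 2) (y : A.A i) (z : A.A j), y ∈ A.part s i → z ∈ A.part t j →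
    A.of i y * A.of j z = (-1 : k) ^ (i * j * s * t) • (A.of j z * A.of i y)

/-- The map of `⨁ A_i` that is `twist` in every degree. -/
noncomputable def T (A : TypedGradedAlgebra.{u, v} k) (c : ℤˣ) : A.Total →ₗ[k] A.Total :=
  DirectSum.lmap fun i => A.twist c i

variable (A : TypedGradedAlgebra.{u, v} k)

theorem T_of (c : ℤˣ) (i : ℕ) (x : A.A i) : A.T c (A.of i x) = A.of i (A.twist c i x) := by
  simp [T]

theorem of_mul {i j p : ℕ} (h : i + j = p) (x : A.A i) (y : A.A j) :
    A.of p (A.mul h x y) = A.of i x * A.of j y := by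
  subst h
  simp only [of, DirectSum.lof_eq_of, DirectSum.of_mul_of]
  rfl

theorem of_injective (i : ℕ) : Function.Injective (A.of i) := DirectSum.of_injective i

theorem twist_part (c : ℤˣ) {i : ℕ} (t : Fin 2) {x : A.A i} (hx : x ∈ A.part t i) :
    A.twist c i x = (c : ℤ) ^ (t : ℕ) • x := by
  fin_cases t
  · simp only [part] at hx
    simp at hx
    simp [twist, Submodule.projection_apply_of_mem_left _ hx,
      Submodule.projection_apply_of_mem_right _ hx]
  · simp only [part] at hx
    simp at hx
    simp [twist, Submodule.projection_apply_of_mem_left _ hx,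
      Submodule.projection_apply_of_mem_right _ hx]

theorem part_induction {i : ℕ} {p : A.A i → Prop} (h : ∀ t, ∀ x ∈ A.part t i, p x)
    (hadd : ∀ x y, p x → p y → p (x + y)) (x : A.A i) : p x := by
  obtain ⟨a, ha, b, hb, rfl⟩ := Submodule.mem_sup.1 ((A.isCompl i).sup_eq_top ▸ Submodule.mem_top (x := x))
  exact hadd _ _ (h 0 _ (by simpa [part])) (h 1 _ (by simpa [part]))

theorem twist_twist (c d : ℤˣ) (i : ℕ) (x : A.A i) :
    A.twist c i (A.twist d i x) = A.twist (c * d) i x := by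
  induction x using A.part_induction with
  | h t x hx =>
    rw [A.twist_part d t hx, map_zsmul, A.twist_part c t hx, A.twist_part (c * d) t hx, smul_smul,
      Units.val_mul, mul_pow, mul_comm]
  | hadd x y hx hy => simp only [map_add, hx, hy]

theorem twist_one (i : ℕ) (x : A.A i) : A.twist 1 i x = x := by
  induction x using A.part_induction with
  | h t x hx => rw [A.twist_part 1 t hx]; simp
  | hadd x y hx hy => simp only [map_add, hx, hy]

theorem twist_zero (c : ℤˣ) (x : A.A 0) : A.twist c 0 x = x := by
  have : x ∈ A.part 0 0 := by
    have := (A.isCompl 0).sup_eq_top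
    rw [A.o_zero, sup_bot_eq] at this
    simp [part, this]
  rw [A.twist_part c 0 this]; simp

end TypedGradedAlgebra

namespace TypedGradedAlgebra
variable (A : TypedGradedAlgebra.{u, v} k)

/-- The partial composition of the operad of a PGPerm algebra, for `x` of degree `m` (arity `m + 1`)
and `y` of degree `n` (arity `n + 1`) and the input `i` of `x`, numbered from `0`.
If `x` has arity `2` and `i` is the second input, it is `((x * Ξ) y) * Ξ` for `y` of arity `1`, and
`(-1)^{Ar(y) t(y)} (x * Ξ) y` otherwise. In all other cases it is `(-1)^{(Ar(y) - 1) i t(x)} x y`, which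
is `x y` if `x` has arity `1` or if `i` is the first input. -/
noncomputable def circA {m n p : ℕ} (h : m + n = p) (i : ℕ) : A.A m →ₗ[k] A.A n →ₗ[k] A.A p :=
  if m = 1 ∧ i = 1 then
    if n = 0 then ((A.mul h).comp (A.twist (-1) m)).compr₂ (A.twist (-1) p)
    else (A.mul h).compl₁₂ (A.twist (-1) m) (A.twist ((-1) ^ (n + 1)) n)
  else (A.mul h).comp (A.twist ((-1) ^ (n * i)) m)

theorem T_T (c d : ℤˣ) (r : A.Total) : A.T c (A.T d r) = A.T (c * d) r := by
  induction r using DirectSum.induction_on with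
  | zero => simp only [map_zero]
  | of i x =>
    change A.T c (A.T d (A.of i x)) = A.T (c * d) (A.of i x)
    rw [T_of, T_of, T_of, twist_twist]
  | add x y hx hy => simp only [map_add, hx, hy]

theorem T_one (r : A.Total) : A.T 1 r = r := by
  induction r using DirectSum.induction_on with
  | zero => simp only [map_zero]
  | of i x =>
    change A.T 1 (A.of i x) = A.of i x
    rw [T_of, twist_one]
  | add x y hx hy => simp only [map_add, hx, hy]

/-- `r` is homogeneous of degree `i`. -/
def H (i : ℕ) (r : A.Total) : Prop := ∃ x, A.of i x = r

variable {A}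
theorem H.mul {i j : ℕ} {r s : A.Total} (hr : A.H i r) (hs : A.H j s) : A.H (i + j) (r * s) := by
  obtain ⟨x, rfl⟩ := hr
  obtain ⟨y, rfl⟩ := hs
  exact ⟨A.mul rfl x y, A.of_mul rfl x y⟩
theorem H.T {i : ℕ} {r : A.Total} (hr : A.H i r) (c : ℤˣ) : A.H i (A.T c r) := by
  obtain ⟨x, rfl⟩ := hr
  exact ⟨_, (A.T_of c i x).symm⟩
theorem H.T_zero {r : A.Total} (hr : A.H 0 r) (c : ℤˣ) : A.T c r = r := by
  obtain ⟨x, rfl⟩ := hr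
  rw [T_of, twist_zero]

theorem IsPGPerm.TL (hA : A.IsPGPerm) (c : ℤˣ) {i j : ℕ} {r s : A.Total} (hr : A.H i r)
    (hs : A.H j s) (hj : 1 ≤ j) : r * A.T c s = A.T c (r * s) := by
  obtain ⟨x, rfl⟩ := hr
  obtain ⟨y, rfl⟩ := hs
  rw [T_of, ← A.of_mul rfl, ← A.of_mul rfl, T_of]
  congr 1
  induction y using A.part_induction with
  | h t y hy =>
    rw [A.twist_part c t hy, A.twist_part c t (hA.left_ideal t rfl x y hj hy), map_zsmul]
  | hadd x y hx hy => simp only [map_add, hx, hy]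

theorem IsPGPerm.TR (hA : A.IsPGPerm) (c : ℤˣ) {i j : ℕ} {r s : A.Total} (hr : A.H i r)
    (hs : A.H j s) (hi : 2 ≤ i) : A.T c r * s = A.T c (r * s) := by
  obtain ⟨x, rfl⟩ := hr
  obtain ⟨y, rfl⟩ := hs
  rw [T_of, ← A.of_mul rfl, ← A.of_mul rfl, T_of]
  congr 1
  induction x using A.part_induction with
  | h t x hx =>
    rw [A.twist_part c t hx, A.twist_part c t (hA.right_ideal t rfl x y hi hx), map_zsmul]; rfl
  | hadd x y hx hy => simp only [map_add, hx, hy, LinearMap.add_apply]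

theorem IsPGPerm.of_circA (hA : A.IsPGPerm) {m n p : ℕ} (h : m + n = p) (i : ℕ) (x : A.A m) (y : A.A n)
    (hi : i ≤ m) :
    A.of p (A.circA h i x y) = if i = 0 then A.of m x * A.of n y else
      A.T ((-1) ^ (n * i + 1)) (A.T (-1) (A.of m x) * A.of n y) := by
  unfold circA
  have Hx : A.H m (A.of m x) := ⟨x, rfl⟩
  have Hy : A.H n (A.of n y) := ⟨y, rfl⟩
  split_ifs with h1 h2 h3 h4 h5
  · omega
  · obtain ⟨rfl, rfl⟩ := h1
    subst h2
    simp only [LinearMap.compr₂_apply, LinearMap.comp_apply]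
    rw [← T_of, of_mul, ← T_of]
    simp
  · omega
  · obtain ⟨rfl, rfl⟩ := h1
    simp only [LinearMap.compl₁₂_apply]
    rw [of_mul, ← T_of, ← T_of, hA.TL _ (Hx.T _) Hy (by omega)]
    simp
  · subst h5
    simp only [LinearMap.comp_apply]
    rw [of_mul, ← T_of]
    simp [T_one]
  · simp only [LinearMap.comp_apply]
    rw [of_mul, ← T_of, ← hA.TR _ (Hx.T _) Hy (by omega), T_T]
    simp [pow_succ]

theorem neg_one_pow_eq {a b : ℕ} (h : a % 2 = b % 2) : (-1 : ℤˣ) ^ a = (-1) ^ b := by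
  rw [← Nat.div_add_mod a 2, ← Nat.div_add_mod b 2, pow_add, pow_mul, pow_add, pow_mul, h]
  simp

theorem sgn_smul (n : ℕ) (t : ℕ) {M : Type*} [AddCommGroup M] [Module k M] (v : M) :
    ((((-1 : ℤˣ) ^ n : ℤˣ) : ℤ) ^ t) • v = (-1 : k) ^ (n * t) • v := by
  rw [pow_mul]
  rcases neg_one_pow_eq_or ℤˣ n with h | h <;> rcases neg_one_pow_eq_or k n with h' | h'
  all_goals
    rcases Nat.even_or_odd n with hn | hn
    · simp [hn.neg_one_pow]
    · simp only [hn.neg_one_pow, Units.val_neg, Units.val_one]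
      rcases Nat.even_or_odd t with ht | ht <;> simp [ht.neg_one_pow]

theorem part_eq_zero {i : ℕ} {s t : Fin 2} (hst : s ≠ t) {x : A.A i} (hs : x ∈ A.part s i)
    (ht : x ∈ A.part t i) : x = 0 := by
  have h := (A.isCompl i).inf_eq_bot
  rw [← Submodule.mem_bot k, ← h, Submodule.mem_inf]
  fin_cases s <;> fin_cases t <;> simp_all [part]

theorem IsPGPerm.swap (hA : A.IsPGPerm) {a b c : ℕ} {x y z : A.Total} (hx : A.H a x) (hy : A.H b y)
    (hz : A.H c z) (ha : 2 ≤ a) : x * y * z = A.T ((-1) ^ (b * c)) (x * z * y) := by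
  rw [← hA.TR _ (hx.mul hz) hy (by omega), ← hA.TR _ hx hz ha]
  obtain ⟨x, rfl⟩ := hx
  obtain ⟨y, rfl⟩ := hy
  obtain ⟨z, rfl⟩ := hz
  rw [T_of]
  induction x using A.part_induction with
  | hadd x x' hx hx' => simp only [map_add, add_mul, hx, hx']
  | h r x hx =>
  induction y using A.part_induction with
  | hadd y y' hy hy' => simp only [map_add, mul_add, add_mul, hy, hy']
  | h s y hy =>
  induction z using A.part_induction with
  | hadd z z' hz hz' => simp only [map_add, mul_add, add_mul, hz, hz']
  | h t z hz =>
  rw [A.twist_part _ r hx, sgn_smul (k := k), map_smul, mul_assoc, hA.perm s t x y z ha hy hz,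
    smul_mul_assoc, smul_mul_assoc, ← mul_assoc]
  rcases Nat.eq_zero_or_pos b with rfl | hb
  · simp
  rcases Nat.eq_zero_or_pos c with rfl | hc
  · simp
  by_cases hrt : r = t
  · subst hrt
    by_cases hrs : r = s
    · subst hrs
      fin_cases r <;> simp
    · have h1 := hA.right_ideal r rfl x z ha hx
      have h2 := hA.right_ideal r rfl _ y (by omega) h1
      have h3 := hA.left_ideal s rfl (A.mul rfl x z) y hb hy
      have h4 : A.of a x * A.of c z * A.of b y = 0 := by
        rw [← A.of_mul rfl, ← A.of_mul rfl, part_eq_zero hrs h2 h3, map_zero]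
      rw [h4]; simp
  · have h1 := hA.right_ideal r rfl x z ha hx
    have h3 := hA.left_ideal t rfl x z hc hz
    have h4 : A.of a x * A.of c z = 0 := by
      rw [← A.of_mul rfl, part_eq_zero hrt h1 h3, map_zero]
    rw [h4]; simp

theorem IsPGPerm.va' (hA : A.IsPGPerm) {x y z : A.Total} (hx : A.H 1 x) (hy : A.H 0 y)
    (hz : A.H 0 z) : A.T (-1) (A.T (-1) (x * y) * z) = A.T (-1) (A.T (-1) x * z) * y := by
  obtain ⟨x, rfl⟩ := hx
  obtain ⟨y, rfl⟩ := hy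
  obtain ⟨z, rfl⟩ := hz
  have := congrArg (A.of 1) (hA.va x y z)
  simpa only [Xi, of_mul, ← T_of] using this

theorem IsPGPerm.vb' (hA : A.IsPGPerm) {c : ℕ} {x y z : A.Total} (hx : A.H 1 x) (hy : A.H 0 y)
    (hz : A.H c z) (hc : 1 ≤ c) : A.T (-1) (x * y) * z = A.T (-1) x * z * y := by
  obtain ⟨x, rfl⟩ := hx
  obtain ⟨y, rfl⟩ := hy
  obtain ⟨z, rfl⟩ := hz
  induction z using A.part_induction with
  | hadd z z' hz hz' => simp only [map_add, mul_add, add_mul, hz, hz']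
  | h t z hz =>
  have := congrArg (A.of (1 + c)) (hA.vb t rfl x y z hc hz)
  simpa only [Xi, of_mul, ← T_of] using this

theorem IsPGPerm.vc' (hA : A.IsPGPerm) {b c : ℕ} {x y z : A.Total} (hx : A.H 1 x) (hy : A.H b y)
    (hz : A.H c z) (hb : 1 ≤ b) (hc : 1 ≤ c) :
    x * A.T ((-1) ^ (c * (b + 1))) y * z = A.T (-1) x * A.T ((-1) ^ (c + 1)) z * y := by
  obtain ⟨x, rfl⟩ := hx
  obtain ⟨y, rfl⟩ := hy
  obtain ⟨z, rfl⟩ := hz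
  generalize hd : (-1 : ℤˣ) ^ (c * (b + 1)) = d
  induction y using A.part_induction with
  | hadd y y' hy hy' => simp only [map_add, mul_add, add_mul, hy, hy']
  | h s y hy =>
  induction z using A.part_induction with
  | hadd z z' hz hz' => simp only [map_add, mul_add, add_mul, hz, hz']
  | h t z hz =>
  subst hd
  have := hA.vc s t x y z hb hc hy hz
  rw [T_of, T_of, T_of, A.twist_part _ s hy, A.twist_part _ t hz, sgn_smul (k := k),
    sgn_smul (k := k), map_smul, map_smul, mul_smul_comm, mul_smul_comm, smul_mul_assoc,
    smul_mul_assoc]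
  obtain ⟨b, rfl⟩ := Nat.exists_eq_add_of_le' hb
  obtain ⟨c, rfl⟩ := Nat.exists_eq_add_of_le' hc
  rw [show (c + 1) * (b + 1 + 1) * (s : ℕ) = (c + 1) * (b + 1 - 1) * s + 2 * ((c + 1) * s) by
      rw [Nat.add_sub_cancel]; ring,
    show (c + 1 + 1) * (t : ℕ) = (c + 1 - 1) * t + 2 * t by rw [Nat.add_sub_cancel]; ring,
    pow_add, pow_add, pow_mul _ 2, pow_mul _ 2]
  simpa [Xi] using this

/-- `circA` as an operation on `⨁ A_i`. -/
noncomputable def cR (A : TypedGradedAlgebra.{u, v} k) (b i : ℕ) (X Y : A.Total) : A.Total :=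
  if i = 0 then X * Y else A.T ((-1) ^ (b * i + 1)) (A.T (-1) X * Y)

theorem cR_ge_two (hA : A.IsPGPerm) {a b i : ℕ} {x y : A.Total} (hx : A.H a x) (hy : A.H b y) (ha : 2 ≤ a) :
    cR A b i x y = A.T ((-1) ^ (b * i)) (x * y) := by
  unfold cR
  split_ifs with h
  · subst h; simp [T_one]
  · rw [hA.TR _ hx hy ha, T_T]; simp [pow_succ]

theorem cR_H {a b i : ℕ} {x y : A.Total} (hx : A.H a x) (hy : A.H b y) : A.H (a + b) (cR A b i x y) := by
  unfold cR
  split_ifs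
  · exact hx.mul hy
  · exact ((hx.T _).mul hy).T _

theorem cR_assoc (hA : A.IsPGPerm) {a b c i j : ℕ} {x y z : A.Total} (hx : A.H a x) (hy : A.H b y)
    (hz : A.H c z) (hi : i ≤ a) (hj : j ≤ b) :
    cR A c (i + j) (cR A b i x y) z = cR A (b + c) i x (cR A c j y z) := by
  have key : ∀ {x : A.Total}, A.H a x → 0 < j → x * (A.T (-1) y * z) = A.T (-1) (x * y) * z := by
    intro x hx hj0
    rw [← mul_assoc, hA.TL _ hx hy (by omega)]
  rcases Nat.eq_zero_or_pos i with rfl | hi0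
  · simp only [cR, if_true, Nat.zero_add]
    split_ifs with h
    · rw [mul_assoc]
    · rw [hA.TL _ hx ((hy.T _).mul hz) (by omega), key hx (by omega)]
  · rcases Nat.eq_zero_or_pos b with rfl | hb
    · obtain rfl : j = 0 := by omega
      have hi' : i ≠ 0 := by omega
      simp only [cR, if_neg hi', if_true, T_T, add_zero, zero_mul, zero_add, pow_one]
      simp [T_one, mul_assoc]
    · have hi' : i ≠ 0 := by omega
      rw [cR_ge_two hA (cR_H hx hy) hz (by omega)]
      simp only [cR, if_neg hi']
      rw [hA.TR _ ((hx.T _).mul hy) hz (by omega), T_T]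
      split_ifs with h
      · subst h
        rw [← mul_assoc, ← pow_add]
        rw [show c * (i + 0) + (b * i + 1) = (b + c) * i + 1 by ring]
      · rw [hA.TL _ (hx.T _) ((hy.T _).mul hz) (by omega), key (hx.T _) (by omega),
          hA.TR _ ((hx.T _).mul hy) hz (by omega), T_T, T_T, ← pow_add, ← pow_add]
        nth_rw 4 [← pow_one (-1 : ℤˣ)]
        rw [← pow_add]
        congr 2
        apply neg_one_pow_eq
        rw [show (b + c) * i + 1 + (c * j + 1) + 1 = c * (i + j) + (b * i + 1) + 2 by ring]
        simp

theorem cR_comm (hA : A.IsPGPerm) {a b c i K : ℕ} {x y z : A.Total} (hx : A.H a x) (hy : A.H b y)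
    (hz : A.H c z) (hi : i < K) (hK : K ≤ a) :
    cR A c (K + b) (cR A b i x y) z = cR A b i (cR A c K x z) y := by
  rcases Nat.lt_or_ge a 2 with ha | ha
  · obtain rfl : a = 1 := by omega
    obtain rfl : i = 0 := by omega
    obtain rfl : K = 1 := by omega
    have h1b : 1 + b ≠ 0 := by omega
    simp only [cR, if_true, if_neg h1b, one_ne_zero, if_false, mul_one]
    rcases Nat.eq_zero_or_pos b with rfl | hb
    · rcases Nat.eq_zero_or_pos c with rfl | hc
      · simpa using hA.va' hx hy hz
      · rw [← hA.TL _ (hx.T _) hz hc, ← hA.vb' hx hy (hz.T _) hc,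
          ← hA.TL _ ((hx.mul hy).T _) hz hc]
        simp
    · rw [hA.TR _ (hx.mul hy) hz (by omega), T_T]
      rcases Nat.eq_zero_or_pos c with rfl | hc
      · have := hA.vb' (hx.T (-1)) hz hy hb
        rw [T_T] at this
        simpa [T_one] using this.symm
      · rw [← hA.TL _ (hx.T _) hz hc, ← hA.vc' hx hy hz hb hc, hA.TL _ hx hy hb,
          hA.TR _ (hx.mul hy) hz (by omega), pow_succ]
        simp [add_comm]
  · rw [cR_ge_two hA (cR_H hx hy) hz (by omega), cR_ge_two hA hx hy ha,
      cR_ge_two hA (cR_H hx hz) hy (by omega), cR_ge_two hA hx hz ha,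
      hA.TR _ (hx.mul hy) hz (by omega), hA.TR _ (hx.mul hz) hy (by omega),
      hA.swap hx hy hz ha, T_T, T_T, T_T, ← pow_add, ← pow_add, ← pow_add]
    congr 2
    apply neg_one_pow_eq
    rw [show c * (K + b) + b * i + b * c = b * i + c * K + 2 * (b * c) by ring]
    simp

theorem cR_act_right (hA : A.IsPGPerm) {a b i : ℕ} {x y : A.Total} (hx : A.H a x) (hy : A.H b y)
    (e : ℤˣ) (he : b = 0 → e = 1) : cR A b i x (A.T e y) = A.T e (cR A b i x y) := by
  rcases Nat.eq_zero_or_pos b with rfl | hb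
  · rw [he rfl, T_one, T_one]
  · unfold cR
    split_ifs
    · exact hA.TL _ hx hy hb
    · rw [hA.TL _ (hx.T _) hy hb, T_T, T_T, mul_comm]

theorem cR_act_left (hA : A.IsPGPerm) {a b i j : ℕ} {x y : A.Total} (hx : A.H a x) (hy : A.H b y)
    (hi : i ≤ a) (hj : j ≤ a) (e : ℤˣ) (he0 : a = 0 → e = 1)
    (he1 : a = 1 → e = (-1) ^ (i + j)) :
    cR A b i (A.T e x) y = A.T ((-1) ^ (b * (i + j)) * e) (cR A b j x y) := by
  rcases Nat.lt_or_ge a 2 with ha | ha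
  · obtain rfl | rfl : a = 0 ∨ a = 1 := by omega
    · obtain rfl : i = 0 := by omega
      obtain rfl : j = 0 := by omega
      rw [he0 rfl]; simp [T_one]
    · rw [he1 rfl]
      obtain rfl | rfl : i = 0 ∨ i = 1 := by omega
      all_goals obtain rfl | rfl : j = 0 ∨ j = 1 := by omega
      all_goals simp [cR, T_T, T_one, ← mul_pow, pow_succ, mul_comm, pow_mul]
  · rw [cR_ge_two hA (hx.T _) hy ha, cR_ge_two hA hx hy ha, hA.TR _ hx hy ha, T_T, T_T]
    congr 1
    rw [mul_right_comm, ← pow_add]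
    congr 2
    apply neg_one_pow_eq
    rw [show b * (i + j) + b * j = b * i + 2 * (b * j) by ring]
    simp

end TypedGradedAlgebra

namespace TypedGradedAlgebra
variable (A : TypedGradedAlgebra.{u, v} k)

theorem IsPGC.TR {A : TypedGradedAlgebra.{u, v} k} (hA : A.IsPGC) (c : ℤˣ) {i j : ℕ}
    {r s : A.Total} (hr : A.H i r) (hs : A.H j s) (hi : 1 ≤ i) : A.T c r * s = A.T c (r * s) := by
  obtain ⟨x, rfl⟩ := hr
  obtain ⟨y, rfl⟩ := hs
  rw [T_of, ← A.of_mul rfl, ← A.of_mul rfl, T_of]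
  congr 1
  induction x using A.part_induction with
  | h t x hx =>
    rw [A.twist_part c t hx, A.twist_part c t (hA.right_ideal t rfl x y hi hx), map_zsmul]; rfl
  | hadd x y hx hy => simp only [map_add, hx, hy, LinearMap.add_apply]

theorem IsPGC.comm_zero {A : TypedGradedAlgebra.{u, v} k} (hA : A.IsPGC) {j : ℕ}
    {r s : A.Total} (hr : A.H 0 r) (hs : A.H j s) : r * s = s * r := by
  obtain ⟨x, rfl⟩ := hr
  obtain ⟨y, rfl⟩ := hs
  induction x using A.part_induction with
  | hadd y y' hy hy' => simp only [map_add, mul_add, add_mul, hy, hy']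
  | h s x hx =>
  induction y using A.part_induction with
  | hadd z z' hz hz' => simp only [map_add, mul_add, add_mul, hz, hz']
  | h t y hy => simpa using hA.comm s t x y hx hy

theorem IsPGC.mul_eq_zero {A : TypedGradedAlgebra.{u, v} k} (hA : A.IsPGC) {i j : ℕ} {s t : Fin 2}
    (hst : s ≠ t) (hi : 1 ≤ i) (hj : 1 ≤ j) {x : A.A i} {y : A.A j} (hx : x ∈ A.part s i)
    (hy : y ∈ A.part t j) : A.of i x * A.of j y = 0 := by
  rw [← A.of_mul rfl, part_eq_zero hst (hA.right_ideal s rfl x y hi hx)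
    (hA.left_ideal t rfl x y hj hy), map_zero]

theorem IsPGC.isPGPerm {A : TypedGradedAlgebra.{u, v} k} (hA : A.IsPGC) : A.IsPGPerm := by
  refine ⟨hA.left_ideal, fun t h x a hi hx => hA.right_ideal t h x a (by omega) hx, ?_, ?_, ?_, ?_⟩
  · intro i j l s t x y z _ hy hz
    rw [hA.comm s t y z hy hz, mul_smul_comm]
  · intro x y z
    apply A.of_injective
    have Hx : A.H 1 (A.of 1 x) := ⟨x, rfl⟩
    have Hy : A.H 0 (A.of 0 y) := ⟨y, rfl⟩
    have Hz : A.H 0 (A.of 0 z) := ⟨z, rfl⟩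
    simp only [Xi, of_mul, ← T_of]
    rw [hA.TR _ (Hx.mul Hy) Hz le_rfl, hA.TR _ Hx Hz le_rfl, T_T, T_T]
    simp only [mul_neg, mul_one, neg_neg, T_one]
    rw [mul_assoc, mul_assoc, hA.comm_zero Hy Hz]
  · intro j p t h x y z _ _
    apply A.of_injective
    have Hx : A.H 1 (A.of 1 x) := ⟨x, rfl⟩
    have Hy : A.H 0 (A.of 0 y) := ⟨y, rfl⟩
    have Hz : A.H j (A.of j z) := ⟨z, rfl⟩
    rw [of_mul, of_mul, of_mul, Xi, ← T_of, ← T_of, of_mul, hA.TR _ (Hx.mul Hy) Hz le_rfl,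
      hA.TR _ Hx Hz le_rfl, hA.TR _ (Hx.mul Hz) Hy (by omega), mul_assoc, mul_assoc,
      hA.comm_zero Hy Hz]
  · intro j l s t x y z hj hl hy hz
    induction x using A.part_induction with
    | hadd x x' hx hx' => simp only [map_add, add_mul, smul_add, hx, hx']
    | h r x hx =>
    rw [Xi, A.twist_part _ r hx, map_zsmul, smul_mul_assoc, smul_mul_assoc]
    by_cases hst : s = t
    · subst hst
      by_cases hrs : r = s
      · subst hrs
        obtain ⟨j, rfl⟩ := Nat.exists_eq_add_of_le' hj
        obtain ⟨l, rfl⟩ := Nat.exists_eq_add_of_le' hl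
        rw [mul_assoc (A.of 1 x) (A.of _ y), mul_assoc (A.of 1 x) (A.of _ z), hA.comm r r y z hy hz, mul_smul_comm, smul_smul,
          Nat.add_sub_cancel, Nat.add_sub_cancel, ← pow_add]
        fin_cases r
        · simp
        · simp only [mul_one, pow_one, Units.val_neg, Units.val_one,
            neg_smul, one_smul, smul_neg]
          rw [show (l + 1) * j + (j + 1) * (l + 1) = l + 1 + 2 * ((l + 1) * j) by ring, pow_add,
            pow_mul]
          simp [pow_succ]
      · rw [hA.mul_eq_zero hrs le_rfl hj hx hy, hA.mul_eq_zero hrs le_rfl hl hx hz]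
        simp
    · rw [mul_assoc (A.of 1 x) (A.of j y), mul_assoc (A.of 1 x) (A.of l z), hA.mul_eq_zero hst hj hl hy hz,
        hA.mul_eq_zero (Ne.symm hst) hl hj hz hy]
      simp

/-- The spaces of operations of the operad of `A`: `0` in arity `0` and `A_n` in arity `n + 1`. -/
def gOp : ℕ → Type v
  | 0 => PUnit
  | n + 1 => A.A n

instance gOp.acg : ∀ n, AddCommGroup (A.gOp n)
  | 0 => (inferInstance : AddCommGroup PUnit.{v + 1})
  | n + 1 => A.acg n

instance gOp.mod : ∀ n, Module k (A.gOp n)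
  | 0 => (inferInstance : Module k PUnit.{v + 1})
  | n + 1 => A.mod n

/-- The symmetric groups act trivially on `A_{n,e}` and by the sign on `A_{n,o}`. -/
noncomputable def gAct : ∀ {n : ℕ}, Equiv.Perm (Fin n) → A.gOp n →ₗ[k] A.gOp n
  | 0, _ => LinearMap.id
  | n + 1, σ => A.twist (Equiv.Perm.sign σ) n

/-- The partial compositions of the operad of `A`. -/
noncomputable def gCirc : ∀ {m n p : ℕ}, m + n = p + 1 → Fin m →
    A.gOp m →ₗ[k] A.gOp n →ₗ[k] A.gOp p
  | m + 1, n + 1, p + 1, h, i => A.circA (by omega : m + n = p) i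
  | _, _, _, _, _ => 0

variable {A}

/-- The inclusion of the operations of arity `n + 1` into the algebra. -/
def gof (A : TypedGradedAlgebra.{u, v} k) (n : ℕ) : A.gOp (n + 1) →ₗ[k] A.Total := A.of n

theorem gof_H {n : ℕ} (x : A.gOp (n + 1)) : A.H n (A.gof n x) := ⟨x, rfl⟩

theorem gof_injective (n : ℕ) : Function.Injective (A.gof n) := A.of_injective n

theorem gof_gAct {n : ℕ} (σ : Equiv.Perm (Fin (n + 1))) (x : A.gOp (n + 1)) :
    A.gof n (A.gAct σ x) = A.T (Equiv.Perm.sign σ) (A.gof n x) :=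
  (A.T_of _ n x).symm

theorem gof_gCirc (hA : A.IsPGPerm) {m n p : ℕ} (h : m + 1 + (n + 1) = p + 1 + 1) (i : Fin (m + 1))
    (x : A.gOp (m + 1)) (y : A.gOp (n + 1)) :
    A.gof p (A.gCirc h i x y) = cR A n i (A.gof m x) (A.gof n y) :=
  hA.of_circA _ _ _ _ (by omega)

theorem gCirc_zero_right {m p : ℕ} (h : m + 0 = p + 1) (i : Fin m) (x : A.gOp m) (y : A.gOp 0) :
    A.gCirc h i x y = 0 := by
  cases m <;> rfl

/-- The identity of the operad of `A` is the unit of `A`. -/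
def gOne (A : TypedGradedAlgebra.{u, v} k) : A.gOp 1 := (GradedMonoid.GOne.one : A.A 0)

theorem gof_one : A.gof 0 A.gOne = 1 := rfl

/-- The operad of a PGPerm algebra. -/
noncomputable def toOperad (A : TypedGradedAlgebra.{u, v} k) (hA : A.IsPGPerm) : Operad.{u, v} k where
  Op := A.gOp
  act := A.gAct
  one := A.gOne
  circ := A.gCirc
  act_one {n} x := by
    cases n with
    | zero => rfl
    | succ n =>
      apply gof_injective
      rw [gof_gAct, map_one, T_one]
  act_mul {n} σ τ x := by
    cases n with
    | zero => rfl
    | succ n =>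
      apply gof_injective
      rw [gof_gAct, gof_gAct, gof_gAct, T_T, map_mul, mul_comm]
  circ_one {n} i θ := by
    cases n with
    | zero => exact i.elim0
    | succ n =>
      apply gof_injective
      rw [gof_gCirc hA, gof_one, cR, mul_one, mul_one, T_T, zero_mul]
      simp [T_one]
  one_circ {n} θ := by
    cases n with
    | zero => rfl
    | succ n =>
      apply gof_injective
      rw [gof_gCirc hA, gof_one, cR]
      simp
  circ_assoc {l m n q r s} hq hs hr hs' i j x y z := by
    obtain ⟨l, rfl⟩ : ∃ l', l = l' + 1 := ⟨l - 1, by have := i.2; omega⟩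
    obtain ⟨m, rfl⟩ : ∃ l', m = l' + 1 := ⟨m - 1, by have := j.2; omega⟩
    obtain ⟨q, rfl⟩ : ∃ l', q = l' + 1 := ⟨q - 1, by omega⟩
    rcases n with _ | n
    · rw [gCirc_zero_right, gCirc_zero_right, map_zero]
    obtain ⟨r, rfl⟩ : ∃ l', r = l' + 1 := ⟨r - 1, by omega⟩
    obtain ⟨s, rfl⟩ : ∃ l', s = l' + 1 := ⟨s - 1, by omega⟩
    apply gof_injective
    rw [gof_gCirc hA, gof_gCirc hA, gof_gCirc hA, gof_gCirc hA]
    obtain rfl : r = m + n := by omega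
    exact cR_assoc hA (gof_H x) (gof_H y) (gof_H z) (by omega) (by omega)
  circ_comm {l m n q r s} hq hs hr hs' i K hiK x y z := by
    have hiK' : i.1 < K.1 := hiK
    obtain ⟨l, rfl⟩ : ∃ l', l = l' + 1 := ⟨l - 1, by have := i.2; omega⟩
    rcases m with _ | m
    · rw [gCirc_zero_right, gCirc_zero_right, map_zero, LinearMap.zero_apply]
    rcases n with _ | n
    · rw [gCirc_zero_right, gCirc_zero_right, map_zero, LinearMap.zero_apply]
    obtain ⟨q, rfl⟩ : ∃ l', q = l' + 1 := ⟨q - 1, by omega⟩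
    obtain ⟨r, rfl⟩ : ∃ l', r = l' + 1 := ⟨r - 1, by omega⟩
    obtain ⟨s, rfl⟩ : ∃ l', s = l' + 1 := ⟨s - 1, by omega⟩
    apply gof_injective
    rw [gof_gCirc hA, gof_gCirc hA, gof_gCirc hA, gof_gCirc hA]
    exact cR_comm hA (gof_H x) (gof_H y) (gof_H z) hiK' (by omega)
  circ_act_right {m n p} h i σ x y := by
    obtain ⟨m, rfl⟩ : ∃ l', m = l' + 1 := ⟨m - 1, by have := i.2; omega⟩
    rcases n with _ | n
    · rw [gCirc_zero_right, gCirc_zero_right, map_zero]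
    obtain ⟨p, rfl⟩ : ∃ l', p = l' + 1 := ⟨p - 1, by omega⟩
    apply gof_injective
    rw [gof_gCirc hA, gof_gAct, gof_gAct, gof_gCirc hA, sign_blockPerm_one_left]
    refine cR_act_right hA (gof_H x) (gof_H y) _ ?_
    rintro rfl
    revert σ
    decide
  circ_act_left {m n p} h i φ x y := by
    obtain ⟨m, rfl⟩ : ∃ l', m = l' + 1 := ⟨m - 1, by have := i.2; omega⟩
    rcases n with _ | n
    · rw [gCirc_zero_right, gCirc_zero_right, map_zero]
    obtain ⟨p, rfl⟩ : ∃ l', p = l' + 1 := ⟨p - 1, by omega⟩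
    apply gof_injective
    rw [gof_gCirc hA, gof_gAct, gof_gAct, gof_gCirc hA, sign_blockPerm, map_one, mul_one,
      neg_one_pow_eq (b := n * (i + φ i))]
    · refine cR_act_left hA (gof_H x) (gof_H y) (by omega) (by omega) _ ?_ ?_
      · rintro rfl
        clear i
        revert φ
        decide
      · rintro rfl
        revert φ i
        decide
    · rw [show (n + 1 + 1) * ((φ i : ℕ) + i) = n * (i + φ i) + 2 * ((φ i : ℕ) + i) by ring]
      simp
  reduced := (inferInstance : Subsingleton PUnit.{v + 1})
  locallyFinite := fun n => by
    cases n with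
    | zero => exact (inferInstance : FiniteDimensional k PUnit.{v + 1})
    | succ n => exact A.locallyFinite n

end TypedGradedAlgebra

namespace Operad
variable (P : Operad.{u, v} k)

theorem circ_heq {m n p p' : ℕ} (h : m + n = p + 1) (h' : m + n = p' + 1) (i : Fin m)
    (x : P.Op m) (y : P.Op n) : HEq (P.circ h i x y) (P.circ h' i x y) := by
  obtain rfl : p = p' := by omega
  rfl

theorem circ_heq' {m m' n n' p p' : ℕ} (h : m + n = p + 1) (h' : m' + n' = p' + 1) (i : Fin m)
    (i' : Fin m') (x : P.Op m) (x' : P.Op m') (y : P.Op n) (y' : P.Op n') (hm : m = m') (hn : n = n')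
    (hi : i.1 = i'.1) (hx : HEq x x') (hy : HEq y y') : HEq (P.circ h i x y) (P.circ h' i' x' y') := by
  subst hm hn
  obtain rfl : p = p' := by omega
  obtain rfl : i = i' := Fin.ext hi
  subst hx hy
  rfl

/-- The graded space with `A_i = P(i + 1)`. -/
abbrev Shift (i : ℕ) : Type v := P.Op (i + 1)

/-- The multiplication `x · y = x ∘_1 y`. -/
def shiftMul {i j : ℕ} : P.Shift i →ₗ[k] P.Shift j →ₗ[k] P.Shift (i + j) :=
  P.circ (by omega : i + 1 + (j + 1) = i + j + 1 + 1) 0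

instance : GradedMonoid.GOne P.Shift := ⟨P.one⟩
instance : GradedMonoid.GMul P.Shift := ⟨fun x y => P.shiftMul x y⟩

instance : GradedMonoid.GMonoid P.Shift where
  one_mul := fun ⟨i, x⟩ => Sigma.ext (Nat.zero_add i) <| by
    refine HEq.trans ?_ (heq_of_eq (P.one_circ x))
    exact P.circ_heq' _ _ _ _ _ _ _ _ rfl rfl rfl HEq.rfl HEq.rfl
  mul_one := fun ⟨i, x⟩ => Sigma.ext (Nat.add_zero i) <| by
    exact heq_of_eq (P.circ_one 0 x)
  mul_assoc := fun ⟨a, x⟩ ⟨b, y⟩ ⟨c, z⟩ => Sigma.ext (Nat.add_assoc a b c) <| by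
    have := P.circ_assoc (by omega : a + 1 + (b + 1) = a + b + 1 + 1)
      (by omega : a + b + 1 + (c + 1) = a + b + c + 1 + 1)
      (by omega : b + 1 + (c + 1) = b + c + 1 + 1)
      (by omega : a + 1 + (b + c + 1) = a + b + c + 1 + 1) 0 0 x y z
    refine HEq.trans (b := P.circ (by omega : a + b + 1 + (c + 1) = a + b + c + 1 + 1) 0
      (P.shiftMul x y) z) HEq.rfl ?_
    refine (heq_of_eq this).trans ?_
    exact P.circ_heq _ _ _ _ _

instance : DirectSum.GRing P.Shift where
  mul_zero _ := map_zero _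
  zero_mul b := by change P.shiftMul 0 b = 0; rw [map_zero]; rfl
  mul_add _ _ _ := map_add _ _ _
  add_mul a b c := by
    change P.shiftMul (a + b) c = P.shiftMul a c + P.shiftMul b c
    rw [map_add]; rfl
  natCast n := n • P.one
  natCast_zero := zero_smul _ _
  natCast_succ n := succ_nsmul _ _
  intCast n := n • P.one
  intCast_ofNat n := natCast_zsmul _ _
  intCast_negSucc_ofNat n := negSucc_zsmul _ _

instance : DirectSum.GAlgebra k P.Shift where
  toFun := (LinearMap.toSpanSingleton k (P.Shift 0) P.one).toAddMonoidHom
  map_one := one_smul k P.one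
  map_mul r s := by
    refine Sigma.ext rfl (heq_of_eq ?_)
    change (r * s) • P.one = P.shiftMul (r • P.one) (s • P.one)
    have : P.shiftMul P.one P.one = P.one := P.circ_one (n := 1) 0 P.one
    rw [map_smul, map_smul, LinearMap.smul_apply, this, smul_smul, mul_comm]
  commutes := fun r ⟨i, x⟩ => by
    refine Sigma.ext ((Nat.zero_add i).trans (Nat.add_zero i).symm) ?_
    refine HEq.trans (b := r • x) ?_ (heq_of_eq ?_)
    · have h1 : P.circ (Nat.add_comm 1 (i + 1)) 0 (r • P.one) x = r • x := by
        rw [map_smul, LinearMap.smul_apply, P.one_circ]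
      rw [← h1]
      exact P.circ_heq' _ _ _ _ _ _ _ _ rfl rfl rfl HEq.rfl HEq.rfl
    · change r • x = P.shiftMul x (r • P.one)
      rw [map_smul]
      exact congrArg (r • ·) (P.circ_one (n := i + 1) 0 x).symm
  smul_def := fun r ⟨i, x⟩ => by
    refine Sigma.ext (Nat.zero_add i).symm ?_
    have h1 : P.circ (Nat.add_comm 1 (i + 1)) 0 (r • P.one) x = r • x := by
      rw [map_smul, LinearMap.smul_apply, P.one_circ]
    change HEq (r • x) _
    rw [← h1]
    exact P.circ_heq' _ _ _ _ _ _ _ _ rfl rfl rfl HEq.rfl HEq.rfl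

/-- The elements of arity `n` fixed by all permutations. -/
def trivPart (n : ℕ) : Submodule k (P.Op n) where
  carrier := {x | ∀ σ : Equiv.Perm (Fin n), P.act σ x = x}
  add_mem' hx hy σ := by rw [map_add, hx σ, hy σ]
  zero_mem' σ := map_zero _
  smul_mem' c x hx σ := by rw [map_smul, hx σ]

/-- The elements of arity `n` on which all permutations act by their sign. -/
def signPart (n : ℕ) : Submodule k (P.Op n) where
  carrier := {x | ∀ σ : Equiv.Perm (Fin n), P.act σ x = ((Equiv.Perm.sign σ : ℤˣ) : ℤ) • x}
  add_mem' hx hy σ := by rw [map_add, hx σ, hy σ, smul_add]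
  zero_mem' σ := by rw [map_zero, smul_zero]
  smul_mem' c x hx σ := by rw [map_smul, hx σ, smul_comm]

theorem isCompl_parts (hk : ringChar k ≠ 2) (hP : aTrivial P) (n : ℕ) :
    IsCompl (P.trivPart (n + 2)) (P.signPart (n + 2)) := by
  have h2 : (2 : k) ≠ 0 := Ring.two_ne_zero hk
  have hτ : Equiv.Perm.sign (Equiv.swap (0 : Fin (n + 2)) 1) = -1 :=
    Equiv.Perm.sign_swap (by simp)
  set τ := Equiv.swap (0 : Fin (n + 2)) 1
  have h1 : ∀ (σ : Equiv.Perm (Fin (n + 2))) (x : P.Op (n + 2)),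
      (Equiv.Perm.sign σ = 1 ∧ P.act σ x = x) ∨ (Equiv.Perm.sign σ = -1 ∧ P.act σ x = P.act τ x) := by
    intro σ x
    rcases Int.units_eq_one_or (Equiv.Perm.sign σ) with h | h
    · exact Or.inl ⟨h, hP _ σ (Equiv.Perm.mem_alternatingGroup.2 h) x⟩
    · refine Or.inr ⟨h, ?_⟩
      have h3 : τ * (τ⁻¹ * σ) = σ := mul_inv_cancel_left _ _
      rw [← h3, P.act_mul]
      refine hP _ _ (Equiv.Perm.mem_alternatingGroup.2 ?_) _
      rw [Equiv.Perm.sign_mul, Equiv.Perm.sign_inv, hτ, h]; rfl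
  have hττ : ∀ x : P.Op (n + 2), P.act τ (P.act τ x) = x := fun x => by
    rw [← P.act_mul, Equiv.swap_mul_self, P.act_one]
  rw [isCompl_iff, disjoint_iff_inf_le, codisjoint_iff_le_sup]
  constructor
  · rintro x ⟨hx, hx'⟩
    have h3 := hx τ
    rw [hx' τ, hτ] at h3
    have h4 : (2 : k) • x = 0 := by
      rw [two_smul]; nth_rw 1 [← h3]; simp
    exact (smul_eq_zero.1 h4).resolve_left h2
  · intro x _
    refine Submodule.mem_sup.2 ⟨(2⁻¹ : k) • (x + P.act τ x), ?_, (2⁻¹ : k) • (x - P.act τ x), ?_, ?_⟩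
    · refine Submodule.smul_mem _ _ fun σ => ?_
      rw [map_add]
      rcases h1 σ x with h | h <;> rcases h1 σ (P.act τ x) with h' | h'
      · rw [h.2, h'.2]
      · rw [h.1] at h'; exact absurd h'.1 (by decide)
      · rw [h.1] at h'; exact absurd h'.1 (by decide)
      · rw [h.2, h'.2, hττ, add_comm x]
    · refine Submodule.smul_mem _ _ fun σ => ?_
      rw [map_sub]
      rcases h1 σ x with h | h <;> rcases h1 σ (P.act τ x) with h' | h'
      · rw [h.2, h'.2, h.1]; simp
      · rw [h.1] at h'; exact absurd h'.1 (by decide)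
      · rw [h.1] at h'; exact absurd h'.1 (by decide)
      · rw [h.2, h'.2, hττ, h.1]; simp
    · rw [← smul_add, add_add_sub_cancel, ← two_smul k, smul_smul, inv_mul_cancel₀ h2, one_smul]

/-- The typed graded algebra of an `𝔸`-trivial operad: `A_i = P(i + 1)` with product `x · y = x ∘_1 y`;
for `i ≥ 1`, `A_{i,e}` is the part of `P(i + 1)` with trivial action and `A_{i,o}` the part with the
sign action. -/
abbrev toAlgebra (hk : ringChar k ≠ 2) (P : Operad.{u, v} k) (hP : aTrivial P) :
    TypedGradedAlgebra.{u, v} k where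
  A := P.Shift
  e
    | 0 => ⊤
    | i + 1 => P.trivPart (i + 2)
  o
    | 0 => ⊥
    | i + 1 => P.signPart (i + 2)
  isCompl
    | 0 => isCompl_top_bot
    | i + 1 => P.isCompl_parts hk hP i
  o_zero := rfl

end Operad

/-- The property of being a PGPerm algebra. -/
def pgPerm : ObjectProperty (TypedGradedAlgebra.{u, v} k) := fun A => A.IsPGPerm

namespace TypedGradedAlgebra

theorem toOperad_aTrivial (A : TypedGradedAlgebra.{u, v} k) (hA : A.IsPGPerm) :
    aTrivial (A.toOperad hA) := by
  intro n σ hσ x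
  cases n with
  | zero => rfl
  | succ n =>
    refine gof_injective (A := A) n ((gof_gAct σ x).trans ?_)
    rw [Equiv.Perm.mem_alternatingGroup.1 hσ, T_one]

theorem Hom.map_twist {A B : TypedGradedAlgebra.{u, v} k} (f : Hom A B) (c : ℤˣ) (i : ℕ) (x : A.A i) :
    f.map i (A.twist c i x) = B.twist c i (f.map i x) := by
  induction x using A.part_induction with
  | hadd x y hx hy => simp only [map_add, hx, hy]
  | h t x hx =>
    have : f.map i x ∈ B.part t i := by
      unfold part at *
      split_ifs at * with h
      · exact f.map_e hx
      · exact f.map_o hx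
    rw [A.twist_part c t hx, B.twist_part c t this, map_zsmul]

theorem Hom.map_mul' {A B : TypedGradedAlgebra.{u, v} k} (f : Hom A B) {i j p : ℕ} (h : i + j = p)
    (x : A.A i) (y : A.A j) : f.map p (A.mul h x y) = B.mul h (f.map i x) (f.map j y) := by
  subst h
  exact f.map_mul x y

/-- The map between the operads of `A` and `B` induced by `f : A ⟶ B`. -/
def gMap {A B : TypedGradedAlgebra.{u, v} k} (f : Hom A B) : ∀ n, A.gOp n →ₗ[k] B.gOp n
  | 0 => LinearMap.id
  | n + 1 => f.map n

theorem Hom.map_circA {A B : TypedGradedAlgebra.{u, v} k} (f : Hom A B) {m n p : ℕ} (h : m + n = p)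
    (i : ℕ) (x : A.A m) (y : A.A n) :
    f.map p (A.circA h i x y) = B.circA h i (f.map m x) (f.map n y) := by
  unfold circA
  split_ifs <;> simp [f.map_mul', f.map_twist]

end TypedGradedAlgebra


namespace TypedGradedAlgebra
variable {A : TypedGradedAlgebra.{u, v} k}

theorem TL_aux (hL : ∀ {i j p : ℕ} (t : Fin 2) (h : i + j = p) (a : A.A i) (x : A.A j), 1 ≤ j →
    x ∈ A.part t j → A.mul h a x ∈ A.part t p) (c : ℤˣ) {i j : ℕ} {r s : A.Total} (hr : A.H i r)
    (hs : A.H j s) (hj : 1 ≤ j) : r * A.T c s = A.T c (r * s) := by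
  obtain ⟨x, rfl⟩ := hr
  obtain ⟨y, rfl⟩ := hs
  rw [T_of, ← A.of_mul rfl, ← A.of_mul rfl, T_of]
  congr 1
  induction y using A.part_induction with
  | h t y hy =>
    rw [A.twist_part c t hy, A.twist_part c t (hL t rfl x y hj hy), map_zsmul]
  | hadd x y hx hy => simp only [map_add, hx, hy]

theorem TR_aux (d : ℕ) (hR : ∀ {i j p : ℕ} (t : Fin 2) (h : i + j = p) (x : A.A i) (a : A.A j), d ≤ i →
    x ∈ A.part t i → A.mul h x a ∈ A.part t p) (c : ℤˣ) {i j : ℕ} {r s : A.Total} (hr : A.H i r)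
    (hs : A.H j s) (hi : d ≤ i) : A.T c r * s = A.T c (r * s) := by
  obtain ⟨x, rfl⟩ := hr
  obtain ⟨y, rfl⟩ := hs
  rw [T_of, ← A.of_mul rfl, ← A.of_mul rfl, T_of]
  congr 1
  induction x using A.part_induction with
  | h t x hx =>
    rw [A.twist_part c t hx, A.twist_part c t (hR t rfl x y hi hx), map_zsmul]; rfl
  | hadd x y hx hy => simp only [map_add, hx, hy, LinearMap.add_apply]

theorem isPGPerm_of
    (hL : ∀ {i j p : ℕ} (t : Fin 2) (h : i + j = p) (a : A.A i) (x : A.A j), 1 ≤ j →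
      x ∈ A.part t j → A.mul h a x ∈ A.part t p)
    (hR : ∀ {i j p : ℕ} (t : Fin 2) (h : i + j = p) (x : A.A i) (a : A.A j), 2 ≤ i →
      x ∈ A.part t i → A.mul h x a ∈ A.part t p)
    (hC : ∀ {a b c : ℕ}, 1 ≤ a → ∀ {X Y Z : A.Total}, A.H a X → A.H b Y → A.H c Z →
      A.T ((-1) ^ (c * (1 + b) + 1)) (A.T (-1) (X * Y) * Z) =
        A.T ((-1) ^ (c + 1)) (A.T (-1) X * Z) * Y) : A.IsPGPerm := by
  have TL := fun (c : ℤˣ) {i j : ℕ} {r s : A.Total} (hr : A.H i r) (hs : A.H j s) (hj : 1 ≤ j) =>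
    TL_aux hL c hr hs hj
  have TR := fun (c : ℤˣ) {i j : ℕ} {r s : A.Total} (hr : A.H i r) (hs : A.H j s) (hi : 2 ≤ i) =>
    TR_aux 2 hR c hr hs hi
  have T_inj : ∀ (c : ℤˣ) {r s : A.Total}, A.T c r = A.T c s → r = s := fun c r s h => by
    have := congrArg (A.T c) h
    rwa [T_T, T_T, Int.units_mul_self, T_one, T_one] at this
  refine ⟨hL, hR, ?_, ?_, ?_, ?_⟩
  · intro a b c s t x y z ha hy hz
    have hX : A.H a (A.of a x) := ⟨x, rfl⟩
    have hY : A.H b (A.of b y) := ⟨y, rfl⟩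
    have hZ : A.H c (A.of c z) := ⟨z, rfl⟩
    have h1 := hC (by omega) hX hY hZ
    have e1 : (-1 : ℤˣ) ^ (c * (1 + b) + 1) * -1 = (-1) ^ c * (-1) ^ (b * c) := by
      rw [← pow_succ, ← pow_add]
      refine neg_one_pow_eq ?_
      rw [show c * (1 + b) + 1 + 1 = c + b * c + 2 by ring]
      simp
    have e2 : (-1 : ℤˣ) ^ (c + 1) * -1 = (-1) ^ c := by simp [pow_succ]
    rw [TR _ (hX.mul hY) hZ (by omega), TR _ hX hZ ha, T_T, T_T, e1, e2,
      TR _ (hX.mul hZ) hY (by omega), ← T_T] at h1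
    replace h1 := congrArg (A.T ((-1) ^ (b * c))) (T_inj _ h1)
    rw [T_T, Int.units_mul_self, T_one] at h1
    rw [← mul_assoc, ← mul_assoc, h1]
    rcases Nat.eq_zero_or_pos b with rfl | hb
    · simp [T_one]
    rcases Nat.eq_zero_or_pos c with rfl | hc
    · simp [T_one]
    have h2 := TL ((-1) ^ (b * c)) (hX.mul hZ) hY hb
    have h3 := TR ((-1) ^ (b * c)) (hX.mul hZ) hY (by omega)
    rw [← TL _ hX hZ hc] at h3
    rw [T_of, A.twist_part _ s hy, sgn_smul (k := k), map_smul, mul_smul_comm] at h2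
    rw [T_of, A.twist_part _ t hz, sgn_smul (k := k), map_smul, mul_smul_comm, smul_mul_assoc] at h3
    fin_cases t
    · rw [← h3]; simp
    · rw [← h2]; simp
  · intro x y z
    have hX : A.H 1 (A.of 1 x) := ⟨x, rfl⟩
    have hY : A.H 0 (A.of 0 y) := ⟨y, rfl⟩
    have hZ : A.H 0 (A.of 0 z) := ⟨z, rfl⟩
    have h1 := hC le_rfl hX hY hZ
    apply A.of_injective
    simpa only [of_mul, ← T_of, Xi, zero_mul, zero_add, pow_one] using h1
  · intro j p t h x y z hj hz
    have hX : A.H 1 (A.of 1 x) := ⟨x, rfl⟩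
    have hY : A.H 0 (A.of 0 y) := ⟨y, rfl⟩
    have hZ : A.H j (A.of j z) := ⟨z, rfl⟩
    have h1 := hC le_rfl hX hY hZ
    apply A.of_injective
    simp only [of_mul, ← T_of, Xi]
    rw [add_zero, mul_one, TR _ ((hX.T _).mul hZ) hY (by omega)] at h1
    exact T_inj _ h1
  · intro b c s t x y z hb hc hy hz
    have hX : A.H 1 (A.of 1 x) := ⟨x, rfl⟩
    have hY : A.H b (A.of b y) := ⟨y, rfl⟩
    have hZ : A.H c (A.of c z) := ⟨z, rfl⟩
    have h1 := hC le_rfl hX hY hZ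
    rw [TR _ (hX.mul hY) hZ (by omega), T_T, ← TL _ (hX.T _) hZ hc, pow_succ, mul_assoc,
      Int.units_mul_self, mul_one, ← TR _ (hX.mul hY) hZ (by omega), ← TL _ hX hY hb, T_of, T_of, T_of,
      A.twist_part _ s hy, A.twist_part _ t hz, sgn_smul (k := k), sgn_smul (k := k), map_smul,
      map_smul, mul_smul_comm, mul_smul_comm, smul_mul_assoc, smul_mul_assoc] at h1
    obtain ⟨b, rfl⟩ := Nat.exists_eq_add_of_le' hb
    obtain ⟨c, rfl⟩ := Nat.exists_eq_add_of_le' hc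
    rw [show (c + 1) * (1 + (b + 1)) * (s : ℕ) = (c + 1) * (b + 1 - 1) * s + 2 * ((c + 1) * s) by
        rw [Nat.add_sub_cancel]; ring,
      show (c + 1 + 1) * (t : ℕ) = (c + 1 - 1) * t + 2 * t by rw [Nat.add_sub_cancel]; ring,
      pow_add, pow_add, pow_mul _ 2, pow_mul _ 2] at h1
    simpa [Xi] using h1

end TypedGradedAlgebra

namespace Operad
variable {P : Operad.{u, v} k} (hk : ringChar k ≠ 2) (hP : aTrivial P)
open TypedGradedAlgebra

theorem exists_sign (n : ℕ) (c : ℤˣ) : ∃ σ : Equiv.Perm (Fin (n + 2)), Equiv.Perm.sign σ = c :=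
  Equiv.Perm.sign_surjective _ c

theorem act_eq_of_sign (hP : aTrivial P) {n : ℕ} {σ τ : Equiv.Perm (Fin n)}
    (h : Equiv.Perm.sign σ = Equiv.Perm.sign τ) (x : P.Op n) : P.act σ x = P.act τ x := by
  have h3 : τ * (τ⁻¹ * σ) = σ := mul_inv_cancel_left _ _
  rw [← h3, P.act_mul]
  refine hP _ _ (Equiv.Perm.mem_alternatingGroup.2 ?_) _
  rw [Equiv.Perm.sign_mul, Equiv.Perm.sign_inv, h]
  simp

theorem mem_part {i : ℕ} (hi : 1 ≤ i) (t : Fin 2) (x : P.Op (i + 1)) :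
    x ∈ (toAlgebra hk P hP).part t i ↔
      ∀ σ : Equiv.Perm (Fin (i + 1)), P.act σ x = ((Equiv.Perm.sign σ : ℤˣ) : ℤ) ^ (t : ℕ) • x := by
  obtain ⟨i, rfl⟩ := Nat.exists_eq_add_of_le' hi
  fin_cases t
  · simp [part]; rfl
  · simp [part]; rfl

theorem act_eq_twist {i : ℕ} (σ : Equiv.Perm (Fin (i + 1))) (x : P.Op (i + 1)) :
    P.act σ x = (toAlgebra hk P hP).twist (Equiv.Perm.sign σ) i x := by
  rcases Nat.eq_zero_or_pos i with rfl | hi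
  · have : σ = 1 := by revert σ; decide
    subst this
    rw [twist_zero, P.act_one]
  · induction x using (toAlgebra hk P hP).part_induction with
    | hadd x y hx hy => rw [map_add, map_add, hx, hy]
    | h t x hx =>
      rw [twist_part _ _ t hx]
      exact (mem_part hk hP hi t x).1 hx σ

theorem toAlgebra_mul {i j p : ℕ} (h : i + j = p) (x : P.Op (i + 1)) (y : P.Op (j + 1)) :
    (toAlgebra hk P hP).mul h x y = P.circ (by omega : i + 1 + (j + 1) = p + 1 + 1) 0 x y := by
  subst h
  rfl

theorem toAlgebra_left_ideal {i j p : ℕ} (t : Fin 2) (h : i + j = p)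
    (a : (toAlgebra hk P hP).A i) (x : (toAlgebra hk P hP).A j) (hj : 1 ≤ j)
    (hx : x ∈ (toAlgebra hk P hP).part t j) :
    (toAlgebra hk P hP).mul h a x ∈ (toAlgebra hk P hP).part t p := by
  refine (mem_part hk hP (by omega) t _).2 fun τ => ?_
  obtain ⟨j, rfl⟩ := Nat.exists_eq_add_of_le' hj
  obtain ⟨σ, hσ⟩ := exists_sign j (Equiv.Perm.sign τ)
  rw [toAlgebra_mul]
  have h1 := (mem_part hk hP hj t x).1 hx σ
  have h2 := P.circ_act_right (by omega : i + 1 + (j + 1 + 1) = p + 1 + 1) 0 σ a x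
  rw [h1, map_zsmul, act_eq_of_sign hP ((sign_blockPerm_one_left _ 0 σ).trans hσ), hσ] at h2
  exact h2.symm

theorem of_circ_eq {m n p : ℕ} (h : m + 1 + (n + 1) = p + 1 + 1) (i : Fin (m + 1))
    (x : P.Op (m + 1)) (y : P.Op (n + 1)) :
    (toAlgebra hk P hP).of p (P.circ h i x y) =
      cR (toAlgebra hk P hP) n i ((toAlgebra hk P hP).of m x) ((toAlgebra hk P hP).of n y) := by
  have h0 : ∀ x : P.Op (m + 1), (toAlgebra hk P hP).of p (P.circ h 0 x y) =
      (toAlgebra hk P hP).of m x * (toAlgebra hk P hP).of n y := fun x => by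
    rw [← of_mul _ (by omega : m + n = p), toAlgebra_mul]
  unfold cR
  split_ifs with hi
  · obtain rfl : i = 0 := Fin.ext hi
    exact h0 x
  · have hi' : (0 : Fin (m + 1)) ≠ i := fun h => hi (by rw [← h]; rfl)
    have h1 := P.circ_act_left h 0 (Equiv.swap 0 i) x y
    rw [act_eq_twist hk hP, act_eq_twist hk hP, sign_blockPerm, Equiv.Perm.sign_swap hi',
      Equiv.swap_apply_left] at h1
    have h2 := congrArg ((toAlgebra hk P hP).of p) h1
    rw [h0, ← T_of, ← T_of] at h2
    rw [h2, T_T]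
    have : (-1 : ℤˣ) ^ (n * (i : ℕ) + 1) * ((-1) ^ ((n + 1 + 1) * ((i : ℕ) + ((0 : Fin (m + 1)) : ℕ))) * -1 *
        Equiv.Perm.sign (1 : Equiv.Perm (Fin (n + 1)))) = 1 := by
      rw [map_one, mul_one, ← pow_succ, ← pow_add, Even.neg_one_pow]
      refine ⟨n * i + i + 1, ?_⟩
      simp; ring
    rw [this, T_one]

theorem toAlgebra_right_ideal {i j p : ℕ} (t : Fin 2) (h : i + j = p)
    (x : (toAlgebra hk P hP).A i) (a : (toAlgebra hk P hP).A j) (hi : 2 ≤ i)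
    (hx : x ∈ (toAlgebra hk P hP).part t i) :
    (toAlgebra hk P hP).mul h x a ∈ (toAlgebra hk P hP).part t p := by
  refine (mem_part hk hP (by omega) t _).2 fun τ => ?_
  obtain ⟨φ, hφ, hφ0⟩ : ∃ φ : Equiv.Perm (Fin (i + 1)), Equiv.Perm.sign φ = Equiv.Perm.sign τ ∧
      φ 0 = 0 := by
    rcases Int.units_eq_one_or (Equiv.Perm.sign τ) with h1 | h1
    · exact ⟨1, by rw [h1, map_one], rfl⟩
    · obtain ⟨i, rfl⟩ := Nat.exists_eq_add_of_le' hi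
      refine ⟨Equiv.swap ⟨1, by omega⟩ ⟨2, by omega⟩, ?_, ?_⟩
      · rw [h1, Equiv.Perm.sign_swap]
        simp
      · exact Equiv.swap_apply_of_ne_of_ne (by simp) (by simp [Fin.ext_iff])
  rw [toAlgebra_mul]
  have h1 := (mem_part hk hP (by omega) t x).1 hx φ
  have h2 := P.circ_act_left (by omega : i + 1 + (j + 1) = p + 1 + 1) 0 φ x a
  have h3 : Equiv.Perm.sign (blockPerm (by omega : i + 1 + (j + 1) = p + 1 + 1) 0 φ
      (1 : Equiv.Perm (Fin (j + 1)))) = Equiv.Perm.sign τ := by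
    rw [sign_blockPerm, hφ0, hφ]; simp
  rw [h1, map_zsmul, act_eq_of_sign hP h3, hφ, hφ0] at h2
  exact h2.symm

theorem toAlgebra_comm {a b c : ℕ} (ha : 1 ≤ a) {X Y Z : (toAlgebra hk P hP).Total}
    (hX : (toAlgebra hk P hP).H a X) (hY : (toAlgebra hk P hP).H b Y)
    (hZ : (toAlgebra hk P hP).H c Z) :
    (toAlgebra hk P hP).T ((-1) ^ (c * (1 + b) + 1)) ((toAlgebra hk P hP).T (-1) (X * Y) * Z) =
      (toAlgebra hk P hP).T ((-1) ^ (c + 1)) ((toAlgebra hk P hP).T (-1) X * Z) * Y := by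
  obtain ⟨x, rfl⟩ := hX
  obtain ⟨y, rfl⟩ := hY
  obtain ⟨z, rfl⟩ := hZ
  obtain ⟨a, rfl⟩ := Nat.exists_eq_add_of_le' ha
  have h1 := P.circ_comm (l := a + 1 + 1) (m := b + 1) (n := c + 1) (q := a + 1 + b + 1)
    (r := a + 1 + c + 1) (s := a + 1 + b + c + 1) (by omega) (by omega) (by omega) (by omega)
    0 1 (by simp) x y z
  have h2 := congrArg ((toAlgebra hk P hP).of (a + 1 + b + c)) h1
  rw [of_circ_eq, of_circ_eq, of_circ_eq, of_circ_eq] at h2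
  have e1 : ((1 : Fin (a + 1 + 1)) : ℕ) + (b + 1) - 1 = 1 + b := by simp; omega
  have e2 : 1 + b ≠ 0 := by omega
  have e3 : 1 + (b + 1) - 1 = 1 + b := by omega
  simpa only [e1, e3, cR, if_neg e2, if_true, one_ne_zero, if_false, Fin.val_one, Fin.val_zero, mul_one] using h2

theorem toAlgebra_isPGPerm : (toAlgebra hk P hP).IsPGPerm :=
  isPGPerm_of (toAlgebra_left_ideal hk hP) (toAlgebra_right_ideal hk hP) (toAlgebra_comm hk hP)

end Operad

/-- The functor `G` from PGPerm algebras to `𝔸`-trivial operads. -/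
noncomputable def functorG : (pgPerm.{u, v} (k := k)).FullSubcategory ⥤
    (aTrivial.{u, v} (k := k)).FullSubcategory where
  obj A := ⟨A.obj.toOperad A.property, A.obj.toOperad_aTrivial A.property⟩
  map {A B} f := ObjectProperty.homMk
    { map := TypedGradedAlgebra.gMap f.hom
      map_act := fun {n} σ x => by
        cases n with
        | zero => rfl
        | succ n => exact TypedGradedAlgebra.Hom.map_twist f.hom _ n x
      map_one := f.hom.map_one
      map_circ := fun {m n p} h i x y => by
        obtain ⟨m, rfl⟩ : ∃ m', m = m' + 1 := ⟨m - 1, by have := i.2; omega⟩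
        rcases n with _ | n
        · exact (congrArg _ (TypedGradedAlgebra.gCirc_zero_right h i x y)).trans
            ((map_zero _).trans (TypedGradedAlgebra.gCirc_zero_right h i _ _).symm)
        obtain ⟨p, rfl⟩ : ∃ m', p = m' + 1 := ⟨p - 1, by omega⟩
        exact TypedGradedAlgebra.Hom.map_circA f.hom _ _ x y }
  map_id A := ObjectProperty.hom_ext _ <| Operad.Hom.ext <| funext fun n => by
    cases n <;> rfl
  map_comp f g := ObjectProperty.hom_ext _ <| Operad.Hom.ext <| funext fun n => by
    cases n <;> rfl

/-- The functor `F` from `𝔸`-trivial operads to PGPerm algebras. -/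
def functorF (hk : ringChar k ≠ 2) : (aTrivial.{u, v} (k := k)).FullSubcategory ⥤
    (pgPerm.{u, v} (k := k)).FullSubcategory where
  obj P := ⟨P.obj.toAlgebra hk P.property, Operad.toAlgebra_isPGPerm hk P.property⟩
  map {P Q} f := ObjectProperty.homMk
    { map := fun i => f.hom.map (i + 1)
      map_one := f.hom.map_one
      map_mul := fun x y => f.hom.map_circ _ _ x y
      map_e := fun {i} x hx => by
        cases i with
        | zero => trivial
        | succ i =>
          intro σ
          rw [← f.hom.map_act, hx σ]
      map_o := fun {i} x hx => by
        cases i with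
        | zero =>
          obtain rfl : x = 0 := hx
          exact map_zero _
        | succ i =>
          intro σ
          rw [← f.hom.map_act, hx σ, map_zsmul] }
  map_id _ := rfl
  map_comp _ _ := rfl

/-- The property of being a PGC algebra. -/
def pgc : ObjectProperty (TypedGradedAlgebra.{u, v} k) := fun A => A.IsPGC

theorem pgc_le_pgPerm : pgc.{u, v} (k := k) ≤ pgPerm := fun _ hA => hA.isPGPerm

/-- Torsionfree graded algebras: `x = 0` whenever `x A_m = 0` for all large `m`, and likewise
whenever `A_m x = 0` for all large `m`. -/
def torsionfreeAlgebra : ObjectProperty (TypedGradedAlgebra.{u, v} k) := fun A =>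
  (∀ x : A.Total, (∃ n : ℕ, ∀ m ≥ n, ∀ y : A.A m, x * A.of m y = 0) → x = 0) ∧
    ∀ x : A.Total, (∃ n : ℕ, ∀ m ≥ n, ∀ y : A.A m, A.of m y * x = 0) → x = 0

/-- Prime algebras: `I J ≠ 0` for all nonzero two-sided ideals `I` and `J`. -/
def primeAlgebra : ObjectProperty (TypedGradedAlgebra.{u, v} k) := fun A =>
  ∀ I J : TwoSidedIdeal A.Total, I ≠ ⊥ → J ≠ ⊥ → ∃ a ∈ I, ∃ b ∈ J, a * b ≠ 0

/-- Operads of infinite total dimension. -/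
def infiniteDimensional : ObjectProperty (Operad.{u, v} k) := fun P =>
  ¬ FiniteDimensional k (⨁ n, P.Op n)

/-- Operads whose algebra of unary operations is commutative. -/
def commutativeUnary : ObjectProperty (Operad.{u, v} k) := fun P =>
  ∀ x y : P.Op 1, P.circ rfl 0 x y = P.circ rfl 0 y x

/-- For functors `G` and `F` in opposite directions between full subcategories `P` and `Q`: `G` and `F`
restrict to functors between the smaller full subcategories `P'` and `Q'`, and these restrictions form
an equivalence of categories. -/
def RestrictToEquivalence {C D : Type*} [Category C] [Category D] {P : ObjectProperty C}
    {Q : ObjectProperty D} (G : P.FullSubcategory ⥤ Q.FullSubcategory)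
    (F : Q.FullSubcategory ⥤ P.FullSubcategory) {P' : ObjectProperty C} {Q' : ObjectProperty D}
    (hP : P' ≤ P) (hQ : Q' ≤ Q) : Prop :=
  ∃ e : P'.FullSubcategory ≌ Q'.FullSubcategory,
    e.functor ⋙ ObjectProperty.ιOfLE hQ = ObjectProperty.ιOfLE hP ⋙ G ∧
      e.inverse ⋙ ObjectProperty.ιOfLE hP = ObjectProperty.ιOfLE hQ ⋙ F

end ATrivial

/-! The functors are quasi-inverse already between all PGPerm algebras and all `𝔸`-trivial operads.
Moving an input to the first place by a transposition expresses every `∘_i` through `∘_1` and the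
symmetric group action, and the action in arity at least two is the same thing as the decomposition
into types. So `∘_1` and the types determine the operad, and both unit and counit are essentially
identities (`unitNatIso`, `counitNatIso`). By `restrictToEquivalence_of_iso` it remains to see that
the functors exchange the two pairs of classes of objects.

The bridge is `exists_circ_eq_twist`: every partial composition is the product up to sign twists on
the odd parts. Hence operad ideals are the graded ideals stable under twists, and vanishing of
composites amounts to vanishing of products (`eq_bot_of_mul_eq_zero`).

Torsion: the PGPerm axioms say that the PGC identities hold after left multiplication by elements of
degree at least two. If nothing nonzero is killed by all elements of large degree on its left, they
hold outright (`IsPGPerm.isPGC`). Commutativity up to sign then gives torsionfreeness on the other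
side too.

Primeness: in a prime operad the ideal of degrees at least `N` kills the ideal of elements that it
annihilates, so one of them is zero. If the operad is nonzero in arbitrarily large arities, this
gives torsionfreeness and hence PGC. Otherwise the highest nonzero positive degree squares to zero,
so everything sits in arity one, where PGC means commutativity. Finally, the even and the odd ideal
of a PGC algebra have product zero, so primeness leaves only one type in positive degrees. Twists
are then scalars, and passing to leading terms reduces arbitrary two-sided ideals to graded ones
(`primeAlgebra_toAlgebra`). -/

namespace ATrivial

variable {k : Type u} [Field k]

/-! ### Restricting quasi-inverse functors to full subcategories -/

/-- Mutually quasi-inverse functors between full subcategories restrict to an equivalence between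
smaller full subcategories that they exchange. -/
theorem restrictToEquivalence_of_iso {C D : Type*} [Category C] [Category D] {P : ObjectProperty C}
    {Q : ObjectProperty D} {G : P.FullSubcategory ⥤ Q.FullSubcategory}
    {F : Q.FullSubcategory ⥤ P.FullSubcategory} {P' : ObjectProperty C} {Q' : ObjectProperty D}
    (hP : P' ≤ P) (hQ : Q' ≤ Q) (η : 𝟭 _ ≅ G ⋙ F) (ε : F ⋙ G ≅ 𝟭 _)
    (hG : ∀ X : P.FullSubcategory, P' X.obj → Q' (G.obj X).obj)
    (hF : ∀ Y : Q.FullSubcategory, Q' Y.obj → P' (F.obj Y).obj) :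
    RestrictToEquivalence G F hP hQ := by
  let G' : P'.FullSubcategory ⥤ Q'.FullSubcategory :=
    Q'.lift (ObjectProperty.ιOfLE hP ⋙ G ⋙ Q.ι) fun X => hG _ X.property
  let F' : Q'.FullSubcategory ⥤ P'.FullSubcategory :=
    P'.lift (ObjectProperty.ιOfLE hQ ⋙ F ⋙ P.ι) fun Y => hF _ Y.property
  let η' : 𝟭 _ ≅ G' ⋙ F' := NatIso.ofComponents
    (fun X => (ObjectProperty.fullyFaithfulιOfLE hP).preimageIso
      (η.app ((ObjectProperty.ιOfLE hP).obj X)))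
    fun {X Y} f => (ObjectProperty.ιOfLE hP).map_injective
      (η.hom.naturality ((ObjectProperty.ιOfLE hP).map f))
  let ε' : F' ⋙ G' ≅ 𝟭 _ := NatIso.ofComponents
    (fun Y => (ObjectProperty.fullyFaithfulιOfLE hQ).preimageIso
      (ε.app ((ObjectProperty.ιOfLE hQ).obj Y)))
    fun {X Y} f => (ObjectProperty.ιOfLE hQ).map_injective
      (ε.hom.naturality ((ObjectProperty.ιOfLE hQ).map f))
  -- `Equivalence.mk` may adjust the unit or counit to obtain the triangle identities but keeps both
  -- functors, so the required equalities of functors are definitional.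
  exact ⟨CategoryTheory.Equivalence.mk G' F' η' ε', rfl, rfl⟩

/-! ### The unit: a PGPerm algebra is recovered from its operad -/

namespace TypedGradedAlgebra
variable {A : TypedGradedAlgebra.{u, v} k}

theorem e_zero : A.e 0 = ⊤ := by
  simpa [A.o_zero] using (A.isCompl 0).sup_eq_top

theorem mem_part_zero (x : A.A 0) : x ∈ A.part 0 0 := by
  simp [part, A.e_zero]

/-- Away from characteristic two the types are the eigenspaces of the twist by `-1`. This turns
membership in a part into an equation, which can be tested after multiplication. -/
theorem mem_part_iff_twist (hk : ringChar k ≠ 2) {i : ℕ} (t : Fin 2) (x : A.A i) :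
    x ∈ A.part t i ↔ ∀ c : ℤˣ, A.twist c i x = (c : ℤ) ^ (t : ℕ) • x := by
  refine ⟨fun hx c => A.twist_part c t hx, fun h => ?_⟩
  have h2 : (2 : k) ≠ 0 := Ring.two_ne_zero hk
  obtain ⟨a, ha, b, hb, rfl⟩ :=
    Submodule.mem_sup.1 ((A.isCompl i).sup_eq_top ▸ Submodule.mem_top (x := x))
  have ha' : a ∈ A.part 0 i := by simpa [part]
  have hb' : b ∈ A.part 1 i := by simpa [part]
  -- The sign `-1` is enough: it sends `a + b` to `a - b`, and comparison with `±(a + b)` leaves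
  -- twice the unwanted component equal to zero.
  have h1 := h (-1)
  rw [map_add, A.twist_part _ 0 ha', A.twist_part _ 1 hb'] at h1
  fin_cases t
  · have : (2 : k) • b = 0 := by
      simp at h1
      rw [two_smul]; nth_rw 1 [← h1]; simp
    obtain rfl := (smul_eq_zero.1 this).resolve_left h2
    simpa using ha'
  · have : (2 : k) • a = 0 := by
      simp at h1
      rw [two_smul]; nth_rw 1 [h1]; simp
    obtain rfl := (smul_eq_zero.1 this).resolve_left h2
    simpa using hb'

theorem toOperad_circ_zero (hA : A.IsPGPerm) {i j p : ℕ} (h : i + 1 + (j + 1) = p + 1 + 1)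
    (x : A.A i) (y : A.A j) :
    (A.toOperad hA).circ h 0 x y = A.mul (by omega : i + j = p) x y := by
  apply gof_injective (A := A)
  refine (gof_gCirc hA h 0 x y).trans ?_
  simp only [cR, Fin.val_zero, if_true]
  exact (A.of_mul _ x y).symm

theorem toAlgebra_toOperad_part (hk : ringChar k ≠ 2) (hA : A.IsPGPerm) (t : Fin 2) (i : ℕ)
    (x : A.A i) :
    x ∈ ((A.toOperad hA).toAlgebra hk (A.toOperad_aTrivial hA)).part t i ↔ x ∈ A.part t i := by
  rcases Nat.eq_zero_or_pos i with rfl | hi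
  · fin_cases t
    · exact iff_of_true (mem_part_zero (A := (A.toOperad hA).toAlgebra hk _) x) (mem_part_zero x)
    · simp [part, A.o_zero]; rfl
  · refine (Operad.mem_part hk (A.toOperad_aTrivial hA) hi t x).trans ?_
    rw [A.mem_part_iff_twist hk]
    obtain ⟨i, rfl⟩ := Nat.exists_eq_add_of_le' hi
    refine ⟨fun h c => ?_, fun h σ => h _⟩
    -- In positive degree the arity is at least two, so both signs come from permutations. This
    -- fails in degree `0`, which was treated separately.
    obtain ⟨σ, rfl⟩ := Operad.exists_sign i c
    exact h σ

/-- A graded algebra is isomorphic to the algebra of its operad. -/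
def unitIso (hk : ringChar k ≠ 2) (hA : A.IsPGPerm) :
    A ≅ (A.toOperad hA).toAlgebra hk (A.toOperad_aTrivial hA) where
  hom :=
    { map := fun i => (LinearMap.id : A.A i →ₗ[k] A.A i)
      map_one := rfl
      map_mul := fun {i j} x y =>
        (toOperad_circ_zero hA (by omega : i + 1 + (j + 1) = i + j + 1 + 1) x y).symm
      map_e := fun {i x} hx => (toAlgebra_toOperad_part hk hA 0 i x).2 hx
      map_o := fun {i x} hx => (toAlgebra_toOperad_part hk hA 1 i x).2 hx }
  inv :=
    { map := fun i => (LinearMap.id : A.A i →ₗ[k] A.A i)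
      map_one := rfl
      map_mul := fun {i j} x y =>
        toOperad_circ_zero hA (by omega : i + 1 + (j + 1) = i + j + 1 + 1) x y
      map_e := fun {i x} hx => (toAlgebra_toOperad_part hk hA 0 i x).1 hx
      map_o := fun {i x} hx => (toAlgebra_toOperad_part hk hA 1 i x).1 hx }

end TypedGradedAlgebra

/-! ### The counit: an `𝔸`-trivial operad is recovered from its algebra -/

namespace Operad
open TypedGradedAlgebra
variable {P : Operad.{u, v} k} (hk : ringChar k ≠ 2) (hP : aTrivial P)

instance (P : Operad.{u, v} k) : Subsingleton (P.Op 0) := P.reduced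

instance (A : TypedGradedAlgebra.{u, v} k) : Subsingleton (A.gOp 0) :=
  (inferInstance : Subsingleton PUnit.{v + 1})

/-- The spaces of operations of the operad of the algebra of `P` are those of `P`. -/
def gOpEquiv : ∀ n, ((P.toAlgebra hk hP).gOp n) ≃ₗ[k] P.Op n
  | 0 => { toFun := fun _ => 0, invFun := fun _ => 0, map_add' := by simp, map_smul' := by simp,
           left_inv := fun _ => Subsingleton.elim _ _, right_inv := fun _ => Subsingleton.elim _ _ }
  | n + 1 => LinearEquiv.refl k (P.Op (n + 1))

theorem gOpEquiv_act {n : ℕ} (σ : Equiv.Perm (Fin n)) (x : (P.toAlgebra hk hP).gOp n) :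
    gOpEquiv hk hP n (gAct _ σ x) = P.act σ (gOpEquiv hk hP n x) := by
  cases n with
  | zero => exact Subsingleton.elim _ _
  | succ n => exact (act_eq_twist hk hP σ x).symm

theorem circ_zero_right {m p : ℕ} (h : m + 0 = p + 1) (i : Fin m) (x : P.Op m) (y : P.Op 0) :
    P.circ h i x y = 0 := by
  rw [Subsingleton.elim y 0, map_zero]

/-- In positive arities both composites equal `cR`: the left one by the construction of the operad,
the right one because equivariance reduces input `i` to the first input (`of_circ_eq`). -/
theorem gOpEquiv_circ {m n p : ℕ} (h : m + n = p + 1) (i : Fin m)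
    (x : (P.toAlgebra hk hP).gOp m) (y : (P.toAlgebra hk hP).gOp n) :
    gOpEquiv hk hP p (gCirc _ h i x y) =
      P.circ h i (gOpEquiv hk hP m x) (gOpEquiv hk hP n y) := by
  obtain ⟨m, rfl⟩ : ∃ m', m = m' + 1 := ⟨m - 1, by have := i.2; omega⟩
  rcases n with _ | n
  · rw [gCirc_zero_right, circ_zero_right, map_zero]
  obtain ⟨p, rfl⟩ : ∃ m', p = m' + 1 := ⟨p - 1, by omega⟩
  apply (P.toAlgebra hk hP).of_injective
  exact (gof_gCirc (toAlgebra_isPGPerm hk hP) h i x y).trans (of_circ_eq hk hP h i x y).symm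

/-- An `𝔸`-trivial operad is isomorphic to the operad of its algebra. -/
def counitIso : (P.toAlgebra hk hP).toOperad (toAlgebra_isPGPerm hk hP) ≅ P where
  hom :=
    { map := fun n => (gOpEquiv hk hP n).toLinearMap
      map_act := gOpEquiv_act hk hP
      map_one := rfl
      map_circ := gOpEquiv_circ hk hP }
  inv :=
    { map := fun n => (gOpEquiv hk hP n).symm.toLinearMap
      -- The inverse inherits its compatibilities from the forward map: apply the injective forward
      -- map to both sides.
      map_act := fun {n} σ x => (gOpEquiv hk hP n).injective <|
        ((gOpEquiv hk hP n).apply_symm_apply _).trans <|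
          (congrArg (P.act σ) ((gOpEquiv hk hP n).apply_symm_apply x).symm).trans
            (gOpEquiv_act hk hP σ _).symm
      map_one := rfl
      map_circ := fun {m n p} h i x y => (gOpEquiv hk hP p).injective <|
        ((gOpEquiv hk hP p).apply_symm_apply _).trans <|
          (congrArg₂ (P.circ h i · ·) ((gOpEquiv hk hP m).apply_symm_apply x).symm
            ((gOpEquiv hk hP n).apply_symm_apply y).symm).trans (gOpEquiv_circ hk hP h i _ _).symm }
  hom_inv_id := Operad.Hom.ext <| funext fun n => LinearMap.ext fun x =>
    (gOpEquiv hk hP n).symm_apply_apply x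
  inv_hom_id := Operad.Hom.ext <| funext fun n => LinearMap.ext fun x =>
    (gOpEquiv hk hP n).apply_symm_apply x

end Operad

/-- The functor `F` is left quasi-inverse to `G`. -/
noncomputable def unitNatIso (hk : ringChar k ≠ 2) :
    𝟭 _ ≅ functorG.{u, v} (k := k) ⋙ functorF hk :=
  NatIso.ofComponents (fun A => ObjectProperty.isoMk _ (TypedGradedAlgebra.unitIso hk A.property))
    fun _ => rfl

/-- The functor `F` is right quasi-inverse to `G`. -/
noncomputable def counitNatIso (hk : ringChar k ≠ 2) :
    functorF hk ⋙ functorG.{u, v} (k := k) ≅ 𝟭 _ :=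
  NatIso.ofComponents (fun P => ObjectProperty.isoMk _ (Operad.counitIso hk P.property))
    fun {P Q} f => ObjectProperty.hom_ext _ <| Operad.Hom.ext <| funext fun n => by
      cases n with
      | zero => exact LinearMap.ext fun x => Subsingleton.elim (α := Q.obj.Op 0) _ _
      | succ n => rfl

/-! ### Homogeneous components of products -/

namespace TypedGradedAlgebra
variable {A : TypedGradedAlgebra.{u, v} k}

theorem of_apply_same (i : ℕ) (x : A.A i) : A.of i x i = x := DirectSum.of_eq_same i x

theorem of_apply_ne {i j : ℕ} (h : j ≠ i) (x : A.A i) : A.of i x j = 0 :=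
  DirectSum.of_eq_of_ne i j x h

theorem of_apply_mem (I : ∀ i, Submodule k (A.A i)) {i : ℕ} {x : A.A i} (hx : x ∈ I i) (j : ℕ) :
    A.of i x j ∈ I j := by
  by_cases hij : j = i
  · subst hij
    rwa [of_apply_same]
  · rw [of_apply_ne hij]; exact zero_mem _

theorem sum_of (r : A.Total) : ∃ s : Finset ℕ, ∑ i ∈ s, A.of i (r i) = r := by
  classical
  exact ⟨_, DirectSum.sum_support_of r⟩

/-- A homogeneous factor only shifts degrees, so annihilation of an inhomogeneous element by
homogeneous ones can be checked component by component. -/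
theorem of_mul_apply {m i p : ℕ} (h : m + i = p) (y : A.A m) (r : A.Total) :
    (A.of m y * r) p = A.mul h y (r i) := by
  subst h
  induction r using DirectSum.induction_on with
  | zero => rw [mul_zero, DirectSum.zero_apply, DirectSum.zero_apply, map_zero]
  | add r s hr hs => rw [mul_add, DirectSum.add_apply, DirectSum.add_apply, hr, hs, map_add]
  | of j z =>
    change (A.of m y * A.of j z) (m + i) = A.mul rfl y (A.of j z i)
    rw [← A.of_mul rfl]
    by_cases hij : i = j
    · subst hij
      rw [of_apply_same, of_apply_same]
    · rw [of_apply_ne (by omega), of_apply_ne hij, map_zero]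

theorem mul_of_apply {m i p : ℕ} (h : i + m = p) (r : A.Total) (y : A.A m) :
    (r * A.of m y) p = A.mul h (r i) y := by
  subst h
  induction r using DirectSum.induction_on with
  | zero => rw [zero_mul, DirectSum.zero_apply, DirectSum.zero_apply, map_zero]; rfl
  | add r s hr hs =>
    rw [add_mul, DirectSum.add_apply, DirectSum.add_apply, hr, hs, map_add]; rfl
  | of j z =>
    change (A.of j z * A.of m y) (i + m) = A.mul rfl (A.of j z i) y
    rw [← A.of_mul rfl]
    by_cases hij : i = j
    · subst hij
      rw [of_apply_same, of_apply_same]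
    · rw [of_apply_ne (by omega), of_apply_ne hij, map_zero]; rfl

/-- The leading term of a product is the product of the leading terms. -/
theorem mul_apply_top {i j : ℕ} {r s : A.Total} (hr : ∀ l > i, r l = 0) (hs : ∀ l > j, s l = 0) :
    (r * s) (i + j) = A.mul rfl (r i) (s j) := by
  obtain ⟨S, hS⟩ := A.sum_of r
  -- For `a < i` the factor from `s` would have degree above `j`; for `a > i` the component `r a` is
  -- already zero.
  have hterm : ∀ a, a ≠ i → (A.of a (r a) * s) (i + j) = 0 := fun a ha => by
    rcases lt_or_gt_of_ne ha with h | h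
    · rw [of_mul_apply (by omega : a + (i - a + j) = i + j), hs _ (by omega), map_zero]
    · rw [hr a h, map_zero, zero_mul, DirectSum.zero_apply]
  have h1 : (r * s) (i + j) = ∑ a ∈ S, (A.of a (r a) * s) (i + j) := by
    nth_rw 1 [← hS]
    rw [Finset.sum_mul]
    exact DFinsupp.finsetSum_apply S _ _
  rw [h1, Finset.sum_eq_single i (fun a _ ha => hterm a ha)]
  · exact of_mul_apply rfl _ _
  · intro hi
    have : r i = 0 := by
      rw [← hS]
      refine (DFinsupp.finsetSum_apply S _ _).trans (Finset.sum_eq_zero fun a ha => ?_)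
      exact of_apply_ne (by rintro rfl; exact hi ha) _
    rw [this, map_zero, zero_mul, DirectSum.zero_apply]

/-! ### Torsionfreeness and the passage from PGPerm to PGC -/

/-- `x = 0` for every homogeneous `x` with `A_m x = 0` for all large `m`. -/
def HomogeneousLeftTorsionfree (A : TypedGradedAlgebra.{u, v} k) : Prop :=
  ∀ (i : ℕ) (x : A.A i), (∃ N : ℕ, ∀ m ≥ N, ∀ y : A.A m, A.of m y * A.of i x = 0) → x = 0

/-- The failure of either missing PGC axiom is measured by a homogeneous element that the PGPerm
axioms make vanish after left multiplication by any element of degree at least two; torsionfreeness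
cancels the factor. -/
theorem IsPGPerm.isPGC (hk : ringChar k ≠ 2) (hA : A.IsPGPerm)
    (hT : A.HomogeneousLeftTorsionfree) : A.IsPGC := by
  refine ⟨hA.left_ideal, ?_, ?_⟩
  · intro i j p t h x a hi hx
    -- Degree `m ≥ 1` is enough: as `i ≥ 1`, the product `y x` has degree at least two, where right
    -- multiplication respects types.
    refine (A.mem_part_iff_twist hk t _).2 fun c => sub_eq_zero.1 (hT p _ ⟨1, fun m hm y => ?_⟩)
    have Hx : A.H i (A.of i x) := ⟨x, rfl⟩
    have Ha : A.H j (A.of j a) := ⟨a, rfl⟩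
    have Hy : A.H m (A.of m y) := ⟨y, rfl⟩
    rw [map_sub, map_zsmul, ← T_of, of_mul, mul_sub, hA.TL c Hy (Hx.mul Ha) (by omega), ← mul_assoc,
      ← hA.TR c (Hy.mul Hx) Ha (by omega), ← hA.TL c Hy Hx hi, T_of, A.twist_part c t hx,
      map_zsmul, mul_smul_comm, mul_smul_comm, smul_mul_assoc, ← mul_assoc, sub_self]
  · intro i j s t y z hy hz
    have h1 : A.of (i + j) (A.mul rfl y z -
        (-1 : k) ^ (i * j * s * t) • A.mul (Nat.add_comm j i) z y) =
        A.of i y * A.of j z - (-1 : k) ^ (i * j * s * t) • (A.of j z * A.of i y) := by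
      rw [map_sub, map_smul, of_mul, of_mul]
    -- The bound `2` is the degree restriction on the left factor in `perm`.
    have h2 := hT _ _ ⟨2, fun m hm x => by
      rw [h1, mul_sub, mul_smul_comm, hA.perm s t x y z hm hy hz, sub_self]⟩
    rw [h2, map_zero] at h1
    exact sub_eq_zero.1 h1.symm

/-- Only `y` needs a type: if `x` has positive degree, its component of the other type has zero
product with `y` in both orders, and degree `0` commutes with everything without sign. This converts
right annihilation into left annihilation. -/
theorem IsPGC.comm_of_part (hA : A.IsPGC) {i m : ℕ} (t : Fin 2) (x : A.A i) {y : A.A m}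
    (hm : 1 ≤ m) (hy : y ∈ A.part t m) :
    A.of m y * A.of i x = (-1 : k) ^ (m * i * t) • (A.of i x * A.of m y) := by
  rcases Nat.eq_zero_or_pos i with rfl | hi
  · simpa using (hA.comm_zero ⟨x, rfl⟩ ⟨y, rfl⟩).symm
  induction x using A.part_induction with
  | hadd x x' hx hx' => simp only [map_add, mul_add, add_mul, smul_add, hx, hx']
  | h s x hx =>
    by_cases hst : s = t
    · subst hst
      rw [hA.comm s s y x hy hx]
      fin_cases s <;> simp
    · rw [hA.mul_eq_zero hst hi hm hx hy, hA.mul_eq_zero (Ne.symm hst) hm hi hy hx, smul_zero]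

theorem IsPGC.torsionfreeAlgebra (hA : A.IsPGC) (hT : A.HomogeneousLeftTorsionfree) :
    torsionfreeAlgebra A := by
  constructor
  · rintro r ⟨n, hn⟩
    -- The shift to `n + 1` makes `m` positive, as `comm_of_part` requires.
    refine DFinsupp.ext fun i => hT i (r i) ⟨n + 1, fun m hm y => ?_⟩
    induction y using A.part_induction with
    | hadd y y' hy hy' => rw [map_add, add_mul, hy, hy', add_zero]
    | h t y hy =>
      rw [hA.comm_of_part t _ (by omega) hy, ← A.of_mul rfl, ← mul_of_apply rfl, hn m (by omega)]
      simp
  · rintro r ⟨n, hn⟩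
    refine DFinsupp.ext fun i => hT i (r i) ⟨n, fun m hm y => ?_⟩
    rw [← A.of_mul rfl, ← of_mul_apply rfl, hn m hm]
    simp

/-- Composites at the first input are the products `y x`, so they alone detect torsion, and only the
second half of `hT` is needed. -/
theorem leftTorsionfree_toOperad (hA : A.IsPGPerm) (hT : torsionfreeAlgebra A) :
    leftTorsionfree (A.toOperad hA) := by
  rintro n x ⟨N, hN⟩
  rcases n with _ | n
  · exact Subsingleton.elim _ _
  · change A.A n at x
    refine A.of_injective n ((hT.2 (A.of n x) ⟨N, fun m hm y => ?_⟩).trans (map_zero _).symm)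
    rw [← A.of_mul rfl, ← toOperad_circ_zero hA (by omega) y x]
    exact (congrArg _ (hN (m + 1) (by omega) _ _ 0 y)).trans (map_zero _)

/-! ### Graded ideals, leading terms and primeness -/

/-- Graded two-sided ideals that are stable under the twists. -/
structure IsGradedIdeal (A : TypedGradedAlgebra.{u, v} k) (I : ∀ i, Submodule k (A.A i)) :
    Prop where
  mul_left : ∀ {i j p : ℕ} (h : i + j = p) (a : A.A i) {x : A.A j}, x ∈ I j → A.mul h a x ∈ I p
  mul_right : ∀ {i j p : ℕ} (h : i + j = p) {x : A.A i} (a : A.A j), x ∈ I i → A.mul h x a ∈ I p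
  twist_mem : ∀ (c : ℤˣ) {i : ℕ} {x : A.A i}, x ∈ I i → A.twist c i x ∈ I i

/-- The ideal of the elements of degree at least `N`. -/
theorem isGradedIdeal_ge (A : TypedGradedAlgebra.{u, v} k)
    (N : ℕ) : A.IsGradedIdeal fun i => if N ≤ i then ⊤ else ⊥ where
  mul_left {i j p} h a x hx := by
    split_ifs at * with h1 h2 h2
    · trivial
    · rw [(Submodule.mem_bot k).1 hx, map_zero]; exact zero_mem _
    · omega
    · rw [(Submodule.mem_bot k).1 hx, map_zero]; exact zero_mem _
  mul_right {i j p} h x a hx := by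
    split_ifs at * with h1 h2 h2
    · trivial
    · rw [(Submodule.mem_bot k).1 hx, map_zero]; exact zero_mem _
    · omega
    · rw [(Submodule.mem_bot k).1 hx, map_zero]; exact zero_mem _
  twist_mem c i x hx := by
    split_ifs at *
    · trivial
    · rw [(Submodule.mem_bot k).1 hx, map_zero]; exact zero_mem _

/-- The ideal of the elements annihilated from the left by all elements of degree at least `N`. -/
def annihilated (A : TypedGradedAlgebra.{u, v} k) (N i : ℕ) :
    Submodule k (A.A i) where
  carrier := {x | ∀ m ≥ N, ∀ y : A.A m, A.of m y * A.of i x = 0}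
  add_mem' hx hx' m hm y := by rw [map_add, mul_add, hx m hm, hx' m hm, add_zero]
  zero_mem' m hm y := by rw [map_zero, mul_zero]
  smul_mem' c x hx m hm y := by rw [map_smul, mul_smul_comm, hx m hm, smul_zero]

/-- If `y` has degree at least `N`, so has `y a`, which gives stability on the left. Twists pass
through left multiplication because the elements of each type and positive degree form a left ideal.
-/
theorem IsPGPerm.isGradedIdeal_annihilated (hA : A.IsPGPerm) (N : ℕ) :
    A.IsGradedIdeal (A.annihilated N) where
  mul_left {i j p} h a x hx m hm y := by
    rw [of_mul, ← mul_assoc, ← of_mul _ rfl, hx _ (by omega)]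
  mul_right {i j p} h x a hx m hm y := by
    rw [of_mul, ← mul_assoc, hx m hm, zero_mul]
  twist_mem c i x hx m hm y := by
    rcases Nat.eq_zero_or_pos i with rfl | hi
    · rw [twist_zero, hx m hm]
    · rw [← T_of, hA.TL c ⟨y, rfl⟩ ⟨x, rfl⟩ hi, hx m hm, map_zero]

/-- These two ideals, even and odd, have product zero. Degree `0` is left out because `part 0 0` is
all of `A_0` and contains the unit. -/
theorem IsPGC.isGradedIdeal_part (hA : A.IsPGC) (t : Fin 2) :
    A.IsGradedIdeal fun i => if 1 ≤ i then A.part t i else ⊥ where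
  mul_left {i j p} h a x hx := by
    split_ifs at * with h1 h2 h2
    · exact hA.left_ideal t h a x h2 hx
    · rw [(Submodule.mem_bot k).1 hx, map_zero]; exact zero_mem _
    · omega
    · rw [(Submodule.mem_bot k).1 hx, map_zero]; exact zero_mem _
  mul_right {i j p} h x a hx := by
    split_ifs at * with h1 h2 h2
    · exact hA.right_ideal t h x a h2 hx
    · rw [(Submodule.mem_bot k).1 hx, map_zero]; exact zero_mem _
    · omega
    · rw [(Submodule.mem_bot k).1 hx, map_zero]; exact zero_mem _
  twist_mem c i x hx := by
    split_ifs at *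
    · rw [twist_part _ c t hx]; exact zsmul_mem hx _
    · rw [(Submodule.mem_bot k).1 hx, map_zero]; exact zero_mem _

/-- The two-sided ideal of the elements whose homogeneous components lie in given subspaces. -/
def homogeneousIdeal (I : ∀ i, Submodule k (A.A i))
    (hl : ∀ {i j p : ℕ} (h : i + j = p) (a : A.A i) {x : A.A j}, x ∈ I j → A.mul h a x ∈ I p)
    (hr : ∀ {i j p : ℕ} (h : i + j = p) {x : A.A i} (a : A.A j), x ∈ I i → A.mul h x a ∈ I p) :
    TwoSidedIdeal A.Total :=
  have hadd : ∀ {r s : A.Total}, (∀ i, r i ∈ I i) → (∀ i, s i ∈ I i) → ∀ i, (r + s) i ∈ I i :=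
    fun hx hy i => by rw [DirectSum.add_apply]; exact add_mem (hx i) (hy i)
  have hsum : ∀ {S : Finset ℕ} {f : ℕ → A.Total}, (∀ a, ∀ i, f a i ∈ I i) →
      ∀ i, (∑ a ∈ S, f a) i ∈ I i := fun {S f} hf i => by
    rw [show (∑ a ∈ S, f a) i = ∑ a ∈ S, f a i from DFinsupp.finsetSum_apply S _ _]
    exact sum_mem fun a _ => hf a i
  .mk' {r | ∀ i, r i ∈ I i} (fun _ => zero_mem _) hadd
    (fun {x} hx i => by
      rw [show (-x) i = -x i from DFinsupp.neg_apply _ _]; exact neg_mem (hx i))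
    (fun {r s} hs => by
      -- Expanding both factors into homogeneous terms leaves only products of homogeneous elements,
      -- to which `hl` applies.
      obtain ⟨S, hS⟩ := A.sum_of s
      induction r using DirectSum.induction_on with
      | zero => intro i; rw [zero_mul]; exact zero_mem _
      | add r r' hr hr' => rw [add_mul]; exact hadd hr hr'
      | of m y =>
        rw [← hS, Finset.mul_sum]
        refine hsum fun a => ?_
        change ∀ i, (A.of m y * A.of a (s a)) i ∈ I i
        rw [← A.of_mul rfl]
        exact of_apply_mem I (hl rfl _ (hs a)))
    (fun {s r} hs => by
      obtain ⟨S, hS⟩ := A.sum_of s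
      induction r using DirectSum.induction_on with
      | zero => intro i; rw [mul_zero]; exact zero_mem _
      | add r r' hr hr' => rw [mul_add]; exact hadd hr hr'
      | of m y =>
        rw [← hS, Finset.sum_mul]
        refine hsum fun a => ?_
        change ∀ i, (A.of a (s a) * A.of m y) i ∈ I i
        rw [← A.of_mul rfl]
        exact of_apply_mem I (hr rfl _ (hs a)))

theorem mem_homogeneousIdeal (I : ∀ i, Submodule k (A.A i)) (hl hr) {r : A.Total} :
    r ∈ homogeneousIdeal (A := A) I hl hr ↔ ∀ i, r i ∈ I i := by
  unfold homogeneousIdeal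
  rw [TwoSidedIdeal.mem_mk']
  rfl

/-- The leading terms of degree `i` of the elements of a two-sided ideal. -/
def leadingPart (I : TwoSidedIdeal A.Total) (i : ℕ) : Submodule k (A.A i) where
  carrier := {x | ∃ r ∈ I, r i = x ∧ ∀ l > i, r l = 0}
  add_mem' := by
    rintro _ _ ⟨r, hr, rfl, hr'⟩ ⟨s, hs, rfl, hs'⟩
    exact ⟨r + s, add_mem hr hs, DirectSum.add_apply _ _ _, fun l hl => by
      rw [DirectSum.add_apply, hr' l hl, hs' l hl, add_zero]⟩
  zero_mem' := ⟨0, zero_mem _, rfl, fun _ _ => rfl⟩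
  smul_mem' := by
    rintro c _ ⟨r, hr, rfl, hr'⟩
    refine ⟨c • r, ?_, DFinsupp.smul_apply _ _ _, fun l hl => ?_⟩
    -- A `TwoSidedIdeal` is closed under scalars because these act as multiplication by ring
    -- elements.
    · rw [Algebra.smul_def]
      exact TwoSidedIdeal.mul_mem_left _ _ _ hr
    · rw [show (c • r) l = c • r l from DFinsupp.smul_apply _ _ _, hr' l hl, smul_zero]

theorem exists_leading {r : A.Total} (hr : r ≠ 0) : ∃ i, r i ≠ 0 ∧ ∀ l > i, r l = 0 := by
  classical
  have hne : (DFinsupp.support r).Nonempty := by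
    rw [Finset.nonempty_iff_ne_empty]
    exact fun h => hr (DFinsupp.support_eq_empty.1 h)
  refine ⟨_, DFinsupp.mem_support_iff.1 (Finset.max'_mem _ hne), fun l hl => ?_⟩
  by_contra hl'
  exact absurd (Finset.le_max' _ l (DFinsupp.mem_support_iff.2 hl')) (not_le.2 hl)

theorem exists_leadingPart_ne_bot {I : TwoSidedIdeal A.Total} (hI : I ≠ ⊥) :
    ∃ i, leadingPart I i ≠ ⊥ := by
  obtain ⟨r, hr, hr0⟩ : ∃ r ∈ I, r ≠ 0 := by
    by_contra! h
    exact hI (le_bot_iff.1 fun r hr => (TwoSidedIdeal.mem_bot _).2 (h r hr))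
  obtain ⟨i, hi, hl⟩ := exists_leading hr0
  exact ⟨i, (Submodule.ne_bot_iff _).2 ⟨r i, ⟨r, hr, rfl, hl⟩, hi⟩⟩

/-- A general two-sided ideal has no reason to be stable under twists. If every twist is a scalar in
each degree, as `hT` asks, then it preserves every subspace. Leading terms may multiply to zero,
which is harmless since `leadingPart` only bounds the degree from above. -/
theorem isGradedIdeal_leadingPart (I : TwoSidedIdeal A.Total)
    (hT : ∀ (c : ℤˣ) (i : ℕ), ∃ n : ℤ, ∀ x : A.A i, A.twist c i x = n • x) :
    A.IsGradedIdeal (leadingPart I) where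
  mul_left := by
    rintro i j p h a _ ⟨r, hr, rfl, hl⟩
    exact ⟨A.of i a * r, I.mul_mem_left _ _ hr, of_mul_apply h a r, fun l hpl => by
      rw [of_mul_apply (by omega : i + (l - i) = l), hl _ (by omega), map_zero]⟩
  mul_right := by
    rintro i j p h _ a ⟨r, hr, rfl, hl⟩
    exact ⟨r * A.of j a, I.mul_mem_right _ _ hr, mul_of_apply h r a, fun l hpl => by
      rw [mul_of_apply (by omega : (l - j) + j = l), hl _ (by omega), map_zero]; rfl⟩
  twist_mem c i x hx := by
    obtain ⟨n, hn⟩ := hT c i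
    rw [hn]
    exact zsmul_mem hx n

/-- An operad ideal is closed under `∘_1`, hence is a homogeneous ideal of the algebra, and a
nonzero product of elements of two such ideals has a nonzero composite of components behind it. -/
theorem primeOperad_toOperad (hA : A.IsPGPerm) (hpr : primeAlgebra A) :
    primeOperad (A.toOperad hA) := by
  intro I J hI hJ hI0 hJ0 hIJ
  have hideal : ∀ K : ∀ n, Submodule k ((A.toOperad hA).Op n), (A.toOperad hA).IsIdeal K → K ≠ ⊥ →
      ∃ K' : TwoSidedIdeal A.Total, K' ≠ ⊥ ∧ ∀ r ∈ K', ∀ i, r i ∈ K (i + 1) := by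
    intro K hK hK0
    refine ⟨homogeneousIdeal (A := A) (fun i => K (i + 1)) ?_ ?_, ?_, fun r hr =>
      (mem_homogeneousIdeal _ _ _).1 hr⟩
    · intro i j p h a x hx
      rw [← toOperad_circ_zero hA (by omega) a x]
      exact hK.circ_mem_right _ 0 _ hx
    · intro i j p h x a hx
      rw [← toOperad_circ_zero hA (by omega) x a]
      exact hK.circ_mem_left _ 0 _ hx
    · obtain ⟨n, hn⟩ := Function.ne_iff.1 hK0
      obtain ⟨x, hx, hx0⟩ := (Submodule.ne_bot_iff _).1 hn
      -- The nonzero element cannot lie in arity `0`, which the algebra does not see but where the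
      -- operad is zero.
      rcases n with _ | n
      · exact absurd (Subsingleton.elim _ _) hx0
      intro h
      have h1 := (TwoSidedIdeal.mem_bot _).1 (h.le ((mem_homogeneousIdeal _ _ _).2
        (of_apply_mem (A := A) (fun i => K (i + 1)) hx)))
      exact hx0 (A.of_injective n (h1.trans (map_zero _).symm))
  obtain ⟨I', hI', hI''⟩ := hideal I hI hI0
  obtain ⟨J', hJ', hJ''⟩ := hideal J hJ hJ0
  obtain ⟨a, ha, b, hb, hab⟩ := hpr I' J' hI' hJ'
  apply hab
  obtain ⟨S, hS⟩ := A.sum_of a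
  obtain ⟨S', hS'⟩ := A.sum_of b
  rw [← hS, ← hS', Finset.sum_mul_sum]
  refine Finset.sum_eq_zero fun i _ => Finset.sum_eq_zero fun j _ => ?_
  have h1 : (A.toOperad hA).circ (by omega : i + 1 + (j + 1) = i + j + 1 + 1) 0 (a i) (b j) ∈
      (A.toOperad hA).subspaceCirc I J (i + j + 1) :=
    Submodule.subset_span ⟨_, _, _, _, _, hI'' a ha i, _, hJ'' b hb j, 1,
      ((A.toOperad hA).act_one _).symm⟩
  rw [hIJ] at h1
  rw [← A.of_mul rfl, ← toOperad_circ_zero hA (by omega) (a i) (b j)]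
  exact (congrArg _ ((Submodule.mem_bot k).1 h1)).trans (map_zero _)

/-- With this, the second alternative in the condition on prime operads holds for every PGC algebra,
whatever its dimension. -/
theorem IsPGC.commutativeUnary_toOperad (hA : A.IsPGC) :
    commutativeUnary (A.toOperad hA.isPGPerm) := by
  intro (x : A.A 0) (y : A.A 0)
  refine (toOperad_circ_zero hA.isPGPerm rfl x y).trans
    (Eq.trans ?_ (toOperad_circ_zero hA.isPGPerm rfl y x).symm)
  apply A.of_injective
  rw [of_mul, of_mul]
  exact hA.comm_zero ⟨x, rfl⟩ ⟨y, rfl⟩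

end TypedGradedAlgebra

/-! ### From operads to algebras -/

namespace Operad
open TypedGradedAlgebra
variable {P : Operad.{u, v} k} (hk : ringChar k ≠ 2) (hP : aTrivial P)

/-- The signs depend only on the degrees and the input, so subspaces stable under twists see no
difference between partial compositions and products. -/
theorem exists_circ_eq_twist {m n p : ℕ} (h : m + 1 + (n + 1) = p + 1 + 1) (i : Fin (m + 1)) :
    ∃ c d : ℤˣ, ∀ (x : P.Op (m + 1)) (y : P.Op (n + 1)), P.circ h i x y =
      (P.toAlgebra hk hP).twist c p
        ((P.toAlgebra hk hP).mul (by omega : m + n = p) ((P.toAlgebra hk hP).twist d m x) y) := by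
  by_cases hi : (i : ℕ) = 0
  · refine ⟨1, 1, fun x y => (P.toAlgebra hk hP).of_injective _ ?_⟩
    rw [of_circ_eq, cR, if_pos hi, twist_one, twist_one, of_mul]
  · refine ⟨(-1) ^ (n * i + 1), -1, fun x y => (P.toAlgebra hk hP).of_injective _ ?_⟩
    rw [of_circ_eq, cR, if_neg hi, ← T_of, of_mul, ← T_of]

theorem homogeneousLeftTorsionfree_toAlgebra (hT : leftTorsionfree P) :
    (P.toAlgebra hk hP).HomogeneousLeftTorsionfree := by
  rintro n x ⟨N, hN⟩
  -- Degree at least `N` is arity at least `N + 1`.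
  refine hT (n + 1) x ⟨N + 1, fun m hm p h i y => ?_⟩
  obtain ⟨m, rfl⟩ : ∃ m', m = m' + 1 := ⟨m - 1, by omega⟩
  obtain ⟨p, rfl⟩ : ∃ p', p = p' + 1 := ⟨p - 1, by omega⟩
  obtain ⟨c, d, hcd⟩ := exists_circ_eq_twist hk hP h i
  have h1 : (P.toAlgebra hk hP).mul (by omega : m + n = p)
      ((P.toAlgebra hk hP).twist d m y) x = 0 :=
    (P.toAlgebra hk hP).of_injective _ <| by rw [of_mul, hN m (by omega), map_zero]
  rw [hcd, h1, map_zero]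

/-- In a prime operad, if all products of two graded ideals of the algebra of the operad vanish,
one of the ideals is zero. -/
theorem eq_bot_of_mul_eq_zero (hpr : primeOperad P)
    {I J : ∀ i, Submodule k ((P.toAlgebra hk hP).A i)} (hI : IsGradedIdeal _ I)
    (hJ : IsGradedIdeal _ J)
    (hIJ : ∀ (i j : ℕ), ∀ x ∈ I i, ∀ y ∈ J j,
      (P.toAlgebra hk hP).of i x * (P.toAlgebra hk hP).of j y = 0) :
    (∀ i, I i = ⊥) ∨ ∀ j, J j = ⊥ := by
  let shift : (∀ i, Submodule k ((P.toAlgebra hk hP).A i)) → ∀ n, Submodule k (P.Op n) :=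
    fun K n => match n with
      | 0 => ⊥
      | n + 1 => K n
  have hshift : ∀ K, IsGradedIdeal _ K → P.IsIdeal (shift K) := fun K hK =>
    { act_mem := fun {n} σ x hx => by
        cases n with
        | zero => rw [Subsingleton.elim (P.act σ x) 0]; exact zero_mem _
        | succ n =>
          rw [act_eq_twist hk hP]
          exact hK.twist_mem _ hx
      circ_mem_left := fun {m n p} h i x y hx => by
        obtain ⟨m, rfl⟩ : ∃ m', m = m' + 1 := ⟨m - 1, by have := i.2; omega⟩
        rcases n with _ | n
        · rw [circ_zero_right]; exact zero_mem _
        obtain ⟨p, rfl⟩ : ∃ p', p = p' + 1 := ⟨p - 1, by omega⟩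
        obtain ⟨c, d, hcd⟩ := exists_circ_eq_twist hk hP h i
        rw [hcd]
        exact hK.twist_mem _ (hK.mul_right _ _ (hK.twist_mem _ hx))
      circ_mem_right := fun {m n p} h i x y hy => by
        obtain ⟨m, rfl⟩ : ∃ m', m = m' + 1 := ⟨m - 1, by have := i.2; omega⟩
        rcases n with _ | n
        · rw [circ_zero_right]; exact zero_mem _
        obtain ⟨p, rfl⟩ : ∃ p', p = p' + 1 := ⟨p - 1, by omega⟩
        obtain ⟨c, d, hcd⟩ := exists_circ_eq_twist hk hP h i
        rw [hcd]
        exact hK.twist_mem _ (hK.mul_left _ _ hy) }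
  by_contra hne
  rw [not_or] at hne
  have hbot : ∀ K, (¬ ∀ i, K i = ⊥) → shift K ≠ ⊥ := fun K hK h =>
    hK fun i => congrFun h (i + 1)
  refine hpr _ _ (hshift I hI) (hshift J hJ) (hbot I hne.1) (hbot J hne.2) ?_
  funext p
  refine le_bot_iff.1 (Submodule.span_le.2 ?_)
  rintro _ ⟨m, n, h, i, x, hx, y, hy, σ, rfl⟩
  suffices P.circ h i x y = 0 by rw [this, map_zero]; exact zero_mem _
  obtain ⟨m, rfl⟩ : ∃ m', m = m' + 1 := ⟨m - 1, by have := i.2; omega⟩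
  rcases n with _ | n
  · exact circ_zero_right _ _ _ _
  obtain ⟨p, rfl⟩ : ∃ p', p = p' + 1 := ⟨p - 1, by omega⟩
  obtain ⟨c, d, hcd⟩ := exists_circ_eq_twist hk hP h i
  -- The left factor occurs twisted by `d`; twist-stability of `I` keeps it within reach of `hIJ`.
  have h1 : (P.toAlgebra hk hP).mul (by omega : m + n = p)
      ((P.toAlgebra hk hP).twist d m x) y = 0 :=
    (P.toAlgebra hk hP).of_injective _ <| by
      rw [of_mul, hIJ m n _ (hI.twist_mem d hx) y hy, map_zero]
  rw [hcd, h1, map_zero]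

/-- The ideal of degrees at least `N` times the ideal it annihilates is zero. By `hinf` the first is
nonzero, so primeness kills the second, for each `N`. -/
theorem homogeneousLeftTorsionfree_of_primeOperad (hpr : primeOperad P)
    (hinf : ∀ N, ∃ n ≥ N, Nontrivial (P.Op (n + 1))) :
    (P.toAlgebra hk hP).HomogeneousLeftTorsionfree := by
  rintro i x ⟨N, hN⟩
  have hmul : ∀ i j, ∀ x ∈ (if N ≤ i then ⊤ else ⊥ : Submodule k ((P.toAlgebra hk hP).A i)),
      ∀ y ∈ annihilated (P.toAlgebra hk hP) N j,
        (P.toAlgebra hk hP).of i x * (P.toAlgebra hk hP).of j y = 0 := by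
    intro i j x hx y hy
    split_ifs at hx with h
    · exact hy i h x
    · rw [(Submodule.mem_bot k).1 hx, map_zero, zero_mul]
  rcases eq_bot_of_mul_eq_zero hk hP hpr (isGradedIdeal_ge _ N)
    ((toAlgebra_isPGPerm hk hP).isGradedIdeal_annihilated N) hmul with h | h
  · obtain ⟨n, hn, hnt⟩ := hinf N
    have := h n
    rw [if_pos hn] at this
    exact absurd this top_ne_bot
  · exact (Submodule.mem_bot k).1 (h i ▸ (show x ∈ annihilated _ N i from hN))

/-- Descent on the vanishing bound: if all degrees above `N ≥ 1` vanish, the ideal of degrees at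
least `N` squares to zero because `2 N ≥ N + 1`, so primeness removes degree `N` as well. The
descent stops at degree `0`, where that inequality fails. -/
theorem subsingleton_of_primeOperad (hk : ringChar k ≠ 2) (hP : aTrivial P)
    (hpr : primeOperad P) (N : ℕ)
    (hN : ∀ n ≥ N, Subsingleton (P.Op (n + 1))) : ∀ n ≥ 1, Subsingleton (P.Op (n + 1)) := by
  induction N with
  | zero => exact fun n _ => hN n (Nat.zero_le n)
  | succ N ih =>
    rcases Nat.eq_zero_or_pos N with rfl | hN0
    · exact hN
    refine ih fun n hn => ?_
    rcases Nat.lt_or_ge N n with h | h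
    · exact hN n h
    obtain rfl : n = N := by omega
    have h1 := eq_bot_of_mul_eq_zero hk hP hpr (isGradedIdeal_ge _ n) (isGradedIdeal_ge _ n) ?_
    · have := (or_self_iff.1 h1) n
      rw [if_pos le_rfl] at this
      exact subsingleton_of_forall_eq 0 fun x =>
        (Submodule.mem_bot k).1 (this ▸ (Submodule.mem_top (x := x)))
    · intro i j x hx y hy
      split_ifs at hx hy with hi hj
      · have := hN (i + j) (by omega)
        rw [← of_mul _ rfl]
        exact (congrArg _ (Subsingleton.elim (α := P.Op (i + j + 1)) _ 0)).trans (map_zero _)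
      all_goals simp_all

theorem isPGC_of_subsingleton (hcomm : commutativeUnary P)
    (h0 : ∀ n ≥ 1, Subsingleton (P.Op (n + 1))) : (P.toAlgebra hk hP).IsPGC := by
  have hz : ∀ {n} (x : (P.toAlgebra hk hP).A n), 1 ≤ n → x = 0 := fun {n} x hn =>
    (h0 n hn).elim _ _
  refine ⟨(toAlgebra_isPGPerm hk hP).left_ideal, fun t h x a hi _ => ?_, fun {i j} s t y z _ _ => ?_⟩
  · rw [hz x hi, map_zero]; exact zero_mem _
  · rcases Nat.eq_zero_or_pos i with rfl | hi
    · rcases Nat.eq_zero_or_pos j with rfl | hj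
      · rw [← of_mul _ rfl, ← of_mul _ rfl, toAlgebra_mul, toAlgebra_mul, hcomm]
        simp
      · rw [hz z hj]; simp
    · rw [hz y hi]; simp

theorem not_infiniteDimensional (N : ℕ) (hN : ∀ n ≥ N, Subsingleton (P.Op (n + 1))) :
    ¬ infiniteDimensional P := by
  refine not_not.2 ?_
  let f : (⨁ n, P.Op n) →ₗ[k] ∀ n : Fin (N + 1), P.Op n :=
    LinearMap.pi fun n => DirectSum.component k ℕ P.Op n
  -- The arities `0, ..., N` kept by `f` are all that can be nonzero, since degree at least `N` is
  -- arity at least `N + 1`.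
  refine FiniteDimensional.of_injective f fun x y hxy => DFinsupp.ext fun n => ?_
  rcases Nat.lt_or_ge n (N + 1) with h | h
  · exact congrFun hxy ⟨n, h⟩
  · obtain ⟨n, rfl⟩ : ∃ m, n = m + 1 := ⟨n - 1, by omega⟩
    exact (hN n (by omega)).elim _ _

/-- Either torsionfreeness forces the PGC identities, or the operad is bounded, hence finite
dimensional and concentrated in arity one. In the second case `h` can only supply commutativity,
which is then all that PGC demands. -/
theorem isPGC_toAlgebra_of_primeOperad (hpr : primeOperad P)
    (h : infiniteDimensional P ∨ commutativeUnary P) : (P.toAlgebra hk hP).IsPGC := by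
  by_cases hinf : ∀ N, ∃ n ≥ N, Nontrivial (P.Op (n + 1))
  · exact (toAlgebra_isPGPerm hk hP).isPGC hk
      (homogeneousLeftTorsionfree_of_primeOperad hk hP hpr hinf)
  · push Not at hinf
    obtain ⟨N, hN⟩ := hinf
    exact isPGC_of_subsingleton hk hP (h.resolve_left (not_infiniteDimensional N hN))
      (subsingleton_of_primeOperad hk hP hpr N hN)

/-- The elements of positive degree of a prime PGC algebra are all of the same type. -/
theorem exists_twist_eq_zsmul (hpr : primeOperad P) (hA : (P.toAlgebra hk hP).IsPGC)
    (c : ℤˣ) (i : ℕ) : ∃ n : ℤ, ∀ x, (P.toAlgebra hk hP).twist c i x = n • x := by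
  rcases Nat.eq_zero_or_pos i with rfl | hi
  · exact ⟨1, fun x => by rw [twist_zero, one_smul]⟩
  replace hi : 1 ≤ i := hi
  have htwo : ∀ t : Fin 2, t = 0 ∨ t = 1 := by decide
  have hmul : ∀ i j, ∀ x ∈ (if 1 ≤ i then part _ 0 i else ⊥ : Submodule k ((P.toAlgebra hk hP).A i)),
      ∀ y ∈ (if 1 ≤ j then part _ 1 j else ⊥ : Submodule k ((P.toAlgebra hk hP).A j)),
        (P.toAlgebra hk hP).of i x * (P.toAlgebra hk hP).of j y = 0 := by
    intro i j x hx y hy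
    split_ifs at hx hy with hi hj
    · exact hA.mul_eq_zero (by decide) hi hj hx hy
    all_goals simp_all
  rcases eq_bot_of_mul_eq_zero hk hP hpr (hA.isGradedIdeal_part 0) (hA.isGradedIdeal_part 1) hmul
    with h | h
  · replace h := h i
    rw [if_pos hi] at h
    -- The even part is zero here, so the twist is multiplication by its sign; in the other case the
    -- odd part is zero and the scalar is `1`.
    refine ⟨(c : ℤ), fun x => ?_⟩
    induction x using (P.toAlgebra hk hP).part_induction with
    | hadd x y hx hy => rw [map_add, hx, hy, smul_add]
    | h t x hx =>
      rcases htwo t with rfl | rfl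
      · rw [h] at hx; rw [(Submodule.mem_bot k).1 hx, map_zero, smul_zero]
      · rw [twist_part _ c 1 hx]; simp
  · replace h := h i
    rw [if_pos hi] at h
    refine ⟨1, fun x => ?_⟩
    induction x using (P.toAlgebra hk hP).part_induction with
    | hadd x y hx hy => rw [map_add, hx, hy, smul_add]
    | h t x hx =>
      rcases htwo t with rfl | rfl
      · rw [twist_part _ c 0 hx]; simp
      · rw [h] at hx; rw [(Submodule.mem_bot k).1 hx, map_zero, smul_zero]

/-- Graded primeness implies primeness: if `I J = 0`, the products of leading terms vanish too. The
leading terms form graded ideals stable under twists, because the positive degrees carry a single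
type, so the primeness of `P` applies. -/
theorem primeAlgebra_toAlgebra (hpr : primeOperad P) (hA : (P.toAlgebra hk hP).IsPGC) :
    primeAlgebra (P.toAlgebra hk hP) := by
  intro I J hI hJ
  by_contra! hIJ
  have hT := exists_twist_eq_zsmul hk hP hpr hA
  have hmul : ∀ i j, ∀ x ∈ leadingPart I i, ∀ y ∈ leadingPart J j,
      (P.toAlgebra hk hP).of i x * (P.toAlgebra hk hP).of j y = 0 := by
    rintro i j _ ⟨r, hr, rfl, hr'⟩ _ ⟨s, hs, rfl, hs'⟩
    rw [← of_mul _ rfl, ← mul_apply_top hr' hs', hIJ r hr s hs]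
    simp
  rcases eq_bot_of_mul_eq_zero hk hP hpr (isGradedIdeal_leadingPart I hT)
    (isGradedIdeal_leadingPart J hT) hmul with h | h
  · obtain ⟨i, hi⟩ := exists_leadingPart_ne_bot hI
    exact hi (h i)
  · obtain ⟨i, hi⟩ := exists_leadingPart_ne_bot hJ
    exact hi (h i)

end Operad

end ATrivial

/-! ### The two equivalences -/

theorem corollary5p10 {k : Type u} [Field k] (hk : ringChar k ≠ 2) :
    ATrivial.RestrictToEquivalence
        (ATrivial.functorG.{u, v} (k := k)) (ATrivial.functorF.{u, v} hk)
        (P' := ATrivial.pgc ⊓ ATrivial.torsionfreeAlgebra)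
        (Q' := ATrivial.aTrivial ⊓ ATrivial.leftTorsionfree)
        (inf_le_left.trans ATrivial.pgc_le_pgPerm) inf_le_left ∧
      ATrivial.RestrictToEquivalence
        (ATrivial.functorG.{u, v} (k := k)) (ATrivial.functorF.{u, v} hk)
        (P' := ATrivial.pgc ⊓ ATrivial.primeAlgebra)
        (Q' := ATrivial.aTrivial ⊓
          (ATrivial.primeOperad ⊓ (ATrivial.infiniteDimensional ⊔ ATrivial.commutativeUnary)))
        (inf_le_left.trans ATrivial.pgc_le_pgPerm) inf_le_left := by
  refine ⟨ATrivial.restrictToEquivalence_of_iso _ _ (ATrivial.unitNatIso hk)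
      (ATrivial.counitNatIso hk) ?_ ?_,
    ATrivial.restrictToEquivalence_of_iso _ _ (ATrivial.unitNatIso hk)
      (ATrivial.counitNatIso hk) ?_ ?_⟩
  · rintro A ⟨-, hT⟩
    exact ⟨(ATrivial.functorG.obj A).property,
      ATrivial.TypedGradedAlgebra.leftTorsionfree_toOperad A.property hT⟩
  · rintro P ⟨-, hT⟩
    have hL := ATrivial.Operad.homogeneousLeftTorsionfree_toAlgebra hk P.property hT
    -- Left torsionfreeness serves twice: it gives the PGC identities here, and with these it yields
    -- torsionfreeness on both sides.
    have hA := (ATrivial.Operad.toAlgebra_isPGPerm hk P.property).isPGC hk hL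
    exact ⟨hA, hA.torsionfreeAlgebra hL⟩
  · rintro A ⟨hA, hpr⟩
    exact ⟨(ATrivial.functorG.obj A).property,
      ATrivial.TypedGradedAlgebra.primeOperad_toOperad A.property hpr,
      Or.inr (ATrivial.TypedGradedAlgebra.IsPGC.commutativeUnary_toOperad hA)⟩
  · rintro P ⟨-, hpr, h⟩
    have hA := ATrivial.Operad.isPGC_toAlgebra_of_primeOperad hk P.property hpr h
    exact ⟨hA, ATrivial.Operad.primeAlgebra_toAlgebra hk P.property hpr hA⟩
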